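/- Let $n$ be a natural number, $u,v\in\mathbb C$, and let $W$ be one of the groups $W_{A_{n-1}}=S_n$, $W_{B_n}$ (all signed permutations of $1,\dots,n$) or $W_{D_n}$ (signed permutations with an even number of sign changes), acting on $\mathbb C^n$ with standard basis $e_1,\dots,e_n$. Let $s_{ij}\in W$ interchange $e_i,e_j$; let $\overline s_{ij}$ (types $B,D$; $i\ne j$) send $e_i\mapsto -e_j$, $e_j\mapsto -e_i$ and fix the other $e_k$; let $\tau_i$ (type $B$) send $e_i\mapsto -e_i$ and fix the other $e_k$. Let $\mathcal C_n$ be the Clifford algebra generated by $c_1,\dots,c_n$ with $c_i^2=1$, $c_ic_j=-c_jc_i$ $(i\neq j)$, on which $W$ acts by permuting the $c_i$ with signs like the $e_i$, and let $K=\mathcal C_n\rtimes\mathbb CW$. The rational double affine Hecke-Clifford algebra $\mathfrak H_W$ is the $\mathbb C$-algebra generated by $x_i,y_i,c_i$ $(1\le i\le n)$ and $W$, subject to the relations of $\mathcal C_n$ and of $W$, to $x_ix_j=x_jx_i$, $y_iy_j=y_jy_i$, $y_ic_j=c_jy_i$ for all $i,j$, to $x_ic_i=-c_ix_i$ and $x_ic_j=c_jx_i$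 $(i\ne j)$, to $wxw^{-1}=w(x)$, $wyw^{-1}=w(y)$, $wcw^{-1}=w(c)$ for $w\in W$, $x\in\bigoplus_i\mathbb Cx_i$, $y\in\bigoplus_i\mathbb Cy_i$, $c\in\mathcal C_n$ (with $w$ acting on the $x_i$ and on the $y_i$ as on the $e_i$), and, for $i\neq j$, to: * type $A$: $[y_j,x_i]=u(1+c_jc_i)s_{ji}$ and $[y_i,x_i]=-u\sum_{k\ne i}(1+c_kc_i)s_{ki}$; * type $D$: $[y_j,x_i]=u\big((1+c_jc_i)s_{ij}-(1-c_jc_i)\overline s_{ij}\big)$ and $[y_i,x_i]=-u\sum_{k\neq i}\big((1+c_kc_i)s_{ki}+(1-c_kc_i)\overline s_{ki}\big)$; * type $B$: $[y_j,x_i]=u\big((1+c_jc_i)s_{ij}-(1-c_jc_i)\overline s_{ij}\big)$ and $[y_i,x_i]=-u\sum_{k\neq i}\big((1+c_kc_i)s_{ki}+(1-c_kc_i)\overline s_{ki}\big)-\sqrt2\,v\,\tau_i$. Let $\mathfrak H_x\subseteq\mathfrak H_W$ be the subalgebra generated by $K$ and $x_1,\dots,x_n$. Let $M$ be any $K$-module.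 Then $M$ extends uniquely to an $\mathfrak H_x$-module on which every $x_i$ acts by $0$, and the map $\mathbb C[y_1,\dots,y_n]\otimes M\to M_x:=\mathfrak H_W\otimes_{\mathfrak H_x}M$, $f\otimes m\mapsto f(y_1,\dots,y_n)\otimes m$, is a linear isomorphism. Under this identification, writing $f^\sigma$ for the action of $\sigma$ on $\mathbb C[y_1,\dots,y_n]$ by algebra automorphisms extending its action on $\bigoplus_i\mathbb Cy_i$, for all $i$, all $f\in\mathbb C[y_1,\dots,y_n]$ and all $m\in M$ the generator $x_i$ acts as follows: * type $B$: $$x_i\circ(f\otimes m)=u\sum_{k\neq i}\frac{f-f^{s_{ki}}}{y_i-y_k}\otimes(1+c_kc_i)s_{ki}m+u\sum_{k\neq i}\frac{f-f^{\overline s_{ki}}}{y_i+y_k}\otimes(1-c_kc_i)\overline s_{ki}m+\sqrt2\,v\,\frac{f-f^{\tau_i}}{2y_i}\otimes\tau_im;$$ * type $A$: $$x_i\circ(f\otimes m)=u\sum_{k\neq i}\frac{f-f^{s_{ki}}}{y_i-y_k}\otimes(1+c_kc_i)s_{ki}m;$$ * type $D$: $$x_i\circ(f\otimes m)=u\sum_{k\neq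 i}\frac{f-f^{s_{ki}}}{y_i-y_k}\otimes(1+c_kc_i)s_{ki}m+u\sum_{k\neq i}\frac{f-f^{\overline s_{ki}}}{y_i+y_k}\otimes(1-c_kc_i)\overline s_{ki}m.$$ -/

import Mathlib

open scoped TensorProduct

noncomputable section

namespace DaHCa

/-! ## Signed permutations and the classical Weyl groups -/

/-- A signed permutation of `n` letters, acting on `ℂⁿ` by `e_i ↦ sign i • e_{perm i}`. -/
@[ext]
structure SignedPerm (n : ℕ) where
  perm : Equiv.Perm (Fin n)
  sign : Fin n → ℤˣ

namespace SignedPerm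

variable {n : ℕ}

instance : One (SignedPerm n) := ⟨⟨1, 1⟩⟩

/-- Composition: `(g * h) e_i = g (h e_i)`. -/
instance : Mul (SignedPerm n) := ⟨fun g h => ⟨g.perm * h.perm, fun i => g.sign (h.perm i) * h.sign i⟩⟩

instance : Inv (SignedPerm n) := ⟨fun g => ⟨g.perm⁻¹, fun i => g.sign (g.perm⁻¹ i)⟩⟩

@[simp] theorem one_perm : (1 : SignedPerm n).perm = 1 := rfl
@[simp] theorem one_sign (i : Fin n) : (1 : SignedPerm n).sign i = 1 := rfl
@[simp] theorem mul_perm (g h : SignedPerm n) : (g * h).perm = g.perm * h.perm := rfl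
@[simp] theorem mul_sign (g h : SignedPerm n) (i : Fin n) :
    (g * h).sign i = g.sign (h.perm i) * h.sign i := rfl
@[simp] theorem inv_perm (g : SignedPerm n) : (g⁻¹).perm = g.perm⁻¹ := rfl
@[simp] theorem inv_sign (g : SignedPerm n) (i : Fin n) :
    (g⁻¹).sign i = g.sign (g.perm⁻¹ i) := rfl

instance : Group (SignedPerm n) :=
  Group.ofLeftAxioms
    (fun a b c => by ext i <;> simp [mul_assoc])
    (fun a => by ext i <;> simp)
    (fun a => by
      ext i
      · simp
      · simp)

/-- The transposition `s_{ij}`: it interchanges `e_i` and `e_j`. -/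
def s (i j : Fin n) : SignedPerm n := ⟨Equiv.swap i j, 1⟩

/-- The element `s̄_{ij}` (used only for `i ≠ j`): the transposition of `i` and `j` coupled with the
sign changes at `i` and `j`, that is, `e_i ↦ -e_j`, `e_j ↦ -e_i`. -/
def sbar (i j : Fin n) : SignedPerm n :=
  ⟨Equiv.swap i j, fun k => (if k = i then -1 else 1) * (if k = j then -1 else 1)⟩

/-- The sign change `τ_i`: `e_i ↦ -e_i`. -/
def tau (i : Fin n) : SignedPerm n := ⟨1, fun k => if k = i then -1 else 1⟩

/-- The linear action on `𝔥 = ℂⁿ`, with `g e_i = sign i • e_{perm i}`. -/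
def toLin (g : SignedPerm n) : (Fin n → ℂ) →ₗ[ℂ] (Fin n → ℂ) where
  toFun a := fun k => ((g.sign (g.perm⁻¹ k) : ℤ) : ℂ) * a (g.perm⁻¹ k)
  map_add' a b := by funext k; simp [mul_add]
  map_smul' r a := by funext k; simp [mul_left_comm]

theorem toLin_apply (g : SignedPerm n) (a : Fin n → ℂ) (k : Fin n) :
    g.toLin a k = ((g.sign (g.perm⁻¹ k) : ℤ) : ℂ) * a (g.perm⁻¹ k) := rfl

theorem toLin_single (g : SignedPerm n) (i : Fin n) :
    g.toLin (Pi.single i 1) = ((g.sign i : ℤ) : ℂ) • Pi.single (g.perm i) 1 := by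
  funext k
  rw [toLin_apply]
  by_cases h : k = g.perm i
  · subst h; simp
  · have h' : g.perm⁻¹ k ≠ i := fun e => h (by rw [← e]; simp)
    rw [Pi.single_eq_of_ne h']
    simp [h]

theorem toLin_one : (1 : SignedPerm n).toLin = LinearMap.id := by
  refine LinearMap.pi_ext' fun i => LinearMap.ext_ring ?_
  simp [toLin_single]

theorem toLin_mul (g h : SignedPerm n) : (g * h).toLin = g.toLin.comp h.toLin := by
  refine LinearMap.pi_ext' fun i => LinearMap.ext_ring ?_
  simp [toLin_single, smul_smul, mul_comm]

/-- The action `f ↦ f^g` on `ℂ[y_1, …, y_n]`: the algebra automorphism with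
`y_i ↦ sign i • y_{perm i}`. -/
def actPoly (g : SignedPerm n) : MvPolynomial (Fin n) ℂ →ₐ[ℂ] MvPolynomial (Fin n) ℂ :=
  MvPolynomial.aeval fun i => ((g.sign i : ℤ) : ℂ) • MvPolynomial.X (g.perm i)

end SignedPerm

open SignedPerm

/-- The Weyl group of type `A_{n-1}`: the permutations. -/
def WA (n : ℕ) : Subgroup (SignedPerm n) where
  carrier := {g | ∀ i, g.sign i = 1}
  mul_mem' {a b} ha hb i := by
    have ha' : ∀ i, a.sign i = 1 := ha
    have hb' : ∀ i, b.sign i = 1 := hb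
    simp [ha', hb']
  one_mem' i := rfl
  inv_mem' {a} ha i := ha _

/-- The Weyl group of type `D_n`: the signed permutations with an even number of sign changes. -/
def WD (n : ℕ) : Subgroup (SignedPerm n) where
  carrier := {g | ∏ i, g.sign i = 1}
  mul_mem' {a b} ha hb := by
    have ha' : ∏ i, a.sign i = 1 := ha
    have hb' : ∏ i, b.sign i = 1 := hb
    change ∏ i, a.sign (b.perm i) * b.sign i = 1
    rw [Finset.prod_mul_distrib, hb', Equiv.prod_comp b.perm a.sign, ha', one_mul]
  one_mem' := by simp
  inv_mem' {a} ha := by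
    have ha' : ∏ i, a.sign i = 1 := ha
    change ∏ i, a.sign (a.perm⁻¹ i) = 1
    rw [Equiv.prod_comp a.perm⁻¹ a.sign, ha']

/-- The Weyl group of type `B_n`: all signed permutations. -/
def WB (n : ℕ) : Subgroup (SignedPerm n) := ⊤

variable {n : ℕ}

theorem s_mem_WA (i j : Fin n) : s i j ∈ WA n := fun _ => rfl
theorem s_mem_WD (i j : Fin n) : s i j ∈ WD n := by
  change ∏ k, (1 : Fin n → ℤˣ) k = 1
  simp
theorem sbar_mem_WD (i j : Fin n) : sbar i j ∈ WD n := by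
  change ∏ k, ((if k = i then (-1 : ℤˣ) else 1) * (if k = j then -1 else 1)) = 1
  rw [Finset.prod_mul_distrib]
  simp

/-- `s_{ij}` in type `A`. -/
def sA (i j : Fin n) : WA n := ⟨s i j, s_mem_WA i j⟩
/-- `s_{ij}` in type `D`. -/
def sD (i j : Fin n) : WD n := ⟨s i j, s_mem_WD i j⟩
/-- `s̄_{ij}` in type `D`. -/
def sbarD (i j : Fin n) : WD n := ⟨sbar i j, sbar_mem_WD i j⟩
/-- `s_{ij}` in type `B`. -/
def sB (i j : Fin n) : WB n := ⟨s i j, Subgroup.mem_top _⟩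
/-- `s̄_{ij}` in type `B`. -/
def sbarB (i j : Fin n) : WB n := ⟨sbar i j, Subgroup.mem_top _⟩
/-- `τ_i` in type `B`. -/
def tauB (i : Fin n) : WB n := ⟨tau i, Subgroup.mem_top _⟩

/-! ## The Clifford algebra and the semidirect product `K = 𝒞_n ⋊ ℂW` -/

/-- The quadratic form `∑ a_i²` on `ℂⁿ`, for which the standard basis is orthonormal. -/
def stdForm (n : ℕ) : QuadraticForm ℂ (Fin n → ℂ) :=
  QuadraticMap.weightedSumSquares ℂ fun _ => (1 : ℂ)

theorem stdForm_apply (a : Fin n → ℂ) : stdForm n a = ∑ i, a i * a i := by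
  simp [stdForm, QuadraticMap.weightedSumSquares_apply]

/-- The Clifford algebra `𝒞_n`. -/
abbrev Cl (n : ℕ) : Type := CliffordAlgebra (stdForm n)

/-- A signed permutation is an isometry of `ℂⁿ`. -/
def isom (g : SignedPerm n) : stdForm n →qᵢ stdForm n where
  toLinearMap := g.toLin
  map_app' a := by
    change stdForm n (g.toLin a) = stdForm n a
    rw [stdForm_apply, stdForm_apply, ← Equiv.sum_comp g.perm⁻¹ fun i => a i * a i]
    refine Finset.sum_congr rfl fun k _ => ?_
    rw [toLin_apply]
    rcases Int.units_eq_one_or (g.sign (g.perm⁻¹ k)) with h | h <;> rw [h] <;> simp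

/-- The action of the signed permutations on `𝒞_n` by algebra automorphisms, induced from the
action on `ℂⁿ`. -/
instance : MulSemiringAction (SignedPerm n) (Cl n) where
  smul g a := CliffordAlgebra.map (isom g) a
  one_smul a := by
    change CliffordAlgebra.map (isom 1) a = a
    have : isom (1 : SignedPerm n) = QuadraticMap.Isometry.id _ := by
      ext a k
      change (1 : SignedPerm n).toLin a k = a k
      simp [toLin_one]
    rw [this, CliffordAlgebra.map_id]; rfl
  mul_smul g h a := by
    change CliffordAlgebra.map (isom (g * h)) a
      = CliffordAlgebra.map (isom g) (CliffordAlgebra.map (isom h) a)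
    have : isom (g * h) = (isom g).comp (isom h) := by
      ext a k
      change (g * h).toLin a k = g.toLin (h.toLin a) k
      simp [toLin_mul]
    rw [this, ← CliffordAlgebra.map_comp_map]; rfl
  smul_zero g := map_zero (CliffordAlgebra.map (isom g))
  smul_add g := map_add (CliffordAlgebra.map (isom g))
  smul_one g := map_one (CliffordAlgebra.map (isom g))
  smul_mul g := map_mul (CliffordAlgebra.map (isom g))

theorem smul_cl_def (g : SignedPerm n) (a : Cl n) : g • a = CliffordAlgebra.map (isom g) a := rfl

instance : SMulCommClass (SignedPerm n) ℂ (Cl n) :=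
  ⟨fun g r a => map_smul (CliffordAlgebra.map (isom g)) r a⟩

variable (W : Subgroup (SignedPerm n))

/-- The semidirect product `K = 𝒞_n ⋊ ℂW`: finite sums of elements `a·g`, `a ∈ 𝒞_n`, `g ∈ W`, with
`(a·g)(b·h) = a g(b)·gh`. -/
abbrev K : Type := SkewMonoidAlgebra (Cl n) W

variable {W}

/-- The Clifford generator `c_i` in `𝒞_n`. -/
def clGen (i : Fin n) : Cl n := CliffordAlgebra.ι (stdForm n) (Pi.single i 1)

/-- `c_i` as an element of `K`. -/
def K.c (i : Fin n) : K W := SkewMonoidAlgebra.single 1 (clGen i)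

/-- `g ∈ W` as an element of `K`. -/
def K.w (g : W) : K W := SkewMonoidAlgebra.of (Cl n) W g

/-! ## The rational double affine Hecke-Clifford algebras -/

/-- The generators `x_i`, `y_i`, `c_i` and the elements of `W`. -/
inductive Gen (W : Subgroup (SignedPerm n)) : Type
  | x (i : Fin n)
  | y (i : Fin n)
  | c (i : Fin n)
  | w (g : W)

variable (W) in
/-- The free algebra on the generators. -/
abbrev Free : Type := FreeAlgebra ℂ (Gen W)

/-- A generator in the free algebra. -/
abbrev gen (a : Gen W) : Free W := FreeAlgebra.ι ℂ a

/-- The defining relations; `κ j i` is the prescribed value of the commutator `[y_j, x_i]`. The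
relations `g v g⁻¹ = g(v)` are imposed on the basis vectors, on which `g` acts by
`e_i ↦ sign i • e_{perm i}`. -/
inductive Rel (κ : Fin n → Fin n → Free W) : Free W → Free W → Prop
  | c_sq (i) : Rel κ (gen (.c i) * gen (.c i)) 1
  | c_anti (i j) (h : i ≠ j) : Rel κ (gen (.c i) * gen (.c j)) (-(gen (.c j) * gen (.c i)))
  | w_one : Rel κ (gen (.w 1)) 1
  | w_mul (g h) : Rel κ (gen (.w (g * h))) (gen (.w g) * gen (.w h))
  | x_comm (i j) : Rel κ (gen (.x i) * gen (.x j)) (gen (.x j) * gen (.x i))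
  | y_comm (i j) : Rel κ (gen (.y i) * gen (.y j)) (gen (.y j) * gen (.y i))
  | y_c (i j) : Rel κ (gen (.y i) * gen (.c j)) (gen (.c j) * gen (.y i))
  | x_c_self (i) : Rel κ (gen (.x i) * gen (.c i)) (-(gen (.c i) * gen (.x i)))
  | x_c (i j) (h : i ≠ j) : Rel κ (gen (.x i) * gen (.c j)) (gen (.c j) * gen (.x i))
  | w_x (g : W) (i) : Rel κ (gen (.w g) * gen (.x i) * gen (.w g⁻¹))
      (((g.1.sign i : ℤ) : ℂ) • gen (.x (g.1.perm i)))
  | w_y (g : W) (i) : Rel κ (gen (.w g) * gen (.y i) * gen (.w g⁻¹))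
      (((g.1.sign i : ℤ) : ℂ) • gen (.y (g.1.perm i)))
  | w_c (g : W) (i) : Rel κ (gen (.w g) * gen (.c i) * gen (.w g⁻¹))
      (((g.1.sign i : ℤ) : ℂ) • gen (.c (g.1.perm i)))
  | y_x (j i) : Rel κ (gen (.y j) * gen (.x i) - gen (.x i) * gen (.y j)) (κ j i)

/-- The algebra generated by `x_i, y_i, c_i` and `W` subject to the relations above. -/
def Alg (κ : Fin n → Fin n → Free W) : Type := (ringConGen (Rel κ)).Quotient

instance (κ : Fin n → Fin n → Free W) : Ring (Alg κ) :=
  inferInstanceAs (Ring (ringConGen (Rel κ)).Quotient)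

instance (κ : Fin n → Fin n → Free W) : Algebra ℂ (Alg κ) :=
  inferInstanceAs (Algebra ℂ (ringConGen (Rel κ)).Quotient)

open Finset in
/-- Commutators `[y_j, x_i]` in type `A_{n-1}`. -/
def kappaA (u : ℂ) (j i : Fin n) : Free (WA n) :=
  if i ≠ j then u • ((1 + gen (.c j) * gen (.c i)) * gen (.w (sA j i)))
  else -(u • ∑ k ∈ univ.erase i, (1 + gen (.c k) * gen (.c i)) * gen (.w (sA k i)))

open Finset in
/-- Commutators `[y_j, x_i]` in type `D_n`. -/
def kappaD (u : ℂ) (j i : Fin n) : Free (WD n) :=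
  if i ≠ j then
    u • ((1 + gen (.c j) * gen (.c i)) * gen (.w (sD i j))
      - (1 - gen (.c j) * gen (.c i)) * gen (.w (sbarD i j)))
  else
    -(u • ∑ k ∈ univ.erase i,
      ((1 + gen (.c k) * gen (.c i)) * gen (.w (sD k i))
        + (1 - gen (.c k) * gen (.c i)) * gen (.w (sbarD k i))))

open Finset in
/-- Commutators `[y_j, x_i]` in type `B_n`. -/
def kappaB (u v : ℂ) (j i : Fin n) : Free (WB n) :=
  if i ≠ j then
    u • ((1 + gen (.c j) * gen (.c i)) * gen (.w (sB i j))
      - (1 - gen (.c j) * gen (.c i)) * gen (.w (sbarB i j)))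
  else
    -(u • ∑ k ∈ univ.erase i,
      ((1 + gen (.c k) * gen (.c i)) * gen (.w (sB k i))
        + (1 - gen (.c k) * gen (.c i)) * gen (.w (sbarB k i))))
      - (((Real.sqrt 2 : ℝ) : ℂ) * v) • gen (.w (tauB i))

/-- The rational double affine Hecke-Clifford algebra of type `A_{n-1}`. -/
abbrev HA (n : ℕ) (u : ℂ) : Type := Alg (kappaA (n := n) u)
/-- The rational double affine Hecke-Clifford algebra of type `D_n`. -/
abbrev HD (n : ℕ) (u : ℂ) : Type := Alg (kappaD (n := n) u)
/-- The rational double affine Hecke-Clifford algebra of type `B_n`. -/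
abbrev HB (n : ℕ) (u v : ℂ) : Type := Alg (kappaB (n := n) u v)

variable (κ : Fin n → Fin n → Free W)

/-- The quotient map from the free algebra. -/
def toAlg : Free W →ₐ[ℂ] Alg κ := (ringConGen (Rel κ)).mkₐ ℂ

theorem toAlg_rel {a b : Free W} (h : Rel κ a b) : toAlg κ a = toAlg κ b :=
  (RingCon.eq _).2 (RingConGen.Rel.of _ _ h)

/-- The generator `x_i`. -/
def x (i : Fin n) : Alg κ := toAlg κ (gen (.x i))
/-- The generator `y_i`. -/
def y (i : Fin n) : Alg κ := toAlg κ (gen (.y i))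
/-- The generator `c_i`. -/
def c (i : Fin n) : Alg κ := toAlg κ (gen (.c i))
/-- The generator `g ∈ W`. -/
def w (g : W) : Alg κ := toAlg κ (gen (.w g))

theorem y_mul_comm (i j : Fin n) : y κ i * y κ j = y κ j * y κ i := by
  simpa [y] using toAlg_rel κ (Rel.y_comm i j)

theorem c_mul_self (i : Fin n) : c κ i * c κ i = 1 := by
  simpa [c] using toAlg_rel κ (Rel.c_sq i)

theorem c_mul_anti {i j : Fin n} (h : i ≠ j) : c κ i * c κ j = -(c κ j * c κ i) := by
  simpa [c] using toAlg_rel κ (Rel.c_anti i j h)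

/-- `W → 𝓗` as a homomorphism of monoids. -/
def wHom : W →* Alg κ where
  toFun := w κ
  map_one' := by simpa [w] using toAlg_rel κ Rel.w_one
  map_mul' g h := by simpa [w] using toAlg_rel κ (Rel.w_mul g h)

theorem w_mul_c (g : W) (i : Fin n) :
    w κ g * c κ i = (((g.1.sign i : ℤ) : ℂ) • c κ (g.1.perm i)) * w κ g := by
  have h : w κ g * c κ i * w κ g⁻¹ = ((g.1.sign i : ℤ) : ℂ) • c κ (g.1.perm i) := by
    simpa [w, c] using toAlg_rel κ (Rel.w_c g i)
  have h1 : w κ g⁻¹ * w κ g = 1 := by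
    change wHom κ g⁻¹ * wHom κ g = 1
    rw [← map_mul, inv_mul_cancel, map_one]
  rw [← h, mul_assoc, h1, mul_one]

/-- The linear map `ℂⁿ → 𝓗`, `e_i ↦ c_i`. -/
def cLin : (Fin n → ℂ) →ₗ[ℂ] Alg κ := Fintype.linearCombination ℂ (c κ)

theorem cLin_apply (a : Fin n → ℂ) : cLin κ a = ∑ i, a i • c κ i :=
  Fintype.linearCombination_apply ..

theorem cLin_single (i : Fin n) : cLin κ (Pi.single i 1) = c κ i := by
  rw [cLin, Fintype.linearCombination_apply_single, one_smul]

theorem cLin_sq (a : Fin n → ℂ) :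
    cLin κ a * cLin κ a = algebraMap ℂ (Alg κ) (stdForm n a) := by
  have e1 : cLin κ a * cLin κ a = ∑ i, ∑ j, (a i * a j) • (c κ i * c κ j) := by
    rw [cLin_apply, Finset.sum_mul_sum]
    refine Finset.sum_congr rfl fun i _ => Finset.sum_congr rfl fun j _ => ?_
    rw [smul_mul_smul_comm]
  have e2 : cLin κ a * cLin κ a = ∑ i, ∑ j, (a i * a j) • (c κ j * c κ i) := by
    rw [e1, Finset.sum_comm]
    refine Finset.sum_congr rfl fun i _ => Finset.sum_congr rfl fun j _ => ?_
    rw [mul_comm (a j)]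
  have e3 : (2 : ℂ) • (cLin κ a * cLin κ a) = (2 : ℂ) • algebraMap ℂ (Alg κ) (stdForm n a) := by
    rw [two_smul, two_smul]
    nth_rewrite 1 [e1]
    rw [e2, ← Finset.sum_add_distrib, stdForm_apply, map_sum, ← Finset.sum_add_distrib]
    refine Finset.sum_congr rfl fun i _ => ?_
    rw [← Finset.sum_add_distrib, Finset.sum_eq_single i]
    · rw [c_mul_self, Algebra.algebraMap_eq_smul_one]
    · intro j _ hj
      rw [c_mul_anti κ hj.symm, smul_neg, neg_add_cancel]
    · simp
  exact smul_right_injective _ (two_ne_zero (α := ℂ)) e3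

/-- The algebra map `𝒞_n → 𝓗`, `c_i ↦ c_i`. -/
def clHom : Cl n →ₐ[ℂ] Alg κ := CliffordAlgebra.lift (stdForm n) ⟨cLin κ, cLin_sq κ⟩

theorem clHom_ι (a : Fin n → ℂ) : clHom κ (CliffordAlgebra.ι (stdForm n) a) = cLin κ a :=
  CliffordAlgebra.lift_ι_apply _ _ _

theorem clHom_comm (g : W) (a : Cl n) : clHom κ (g • a) * w κ g = w κ g * clHom κ a := by
  change clHom κ (CliffordAlgebra.map (isom g.1) a) * w κ g = w κ g * clHom κ a
  induction a using CliffordAlgebra.induction with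
  | algebraMap r => simp [Algebra.commutes]
  | ι a =>
    rw [CliffordAlgebra.map_apply_ι, clHom_ι, clHom_ι]
    have key : (LinearMap.mulRight ℂ (w κ g)).comp ((cLin κ).comp g.1.toLin)
        = (LinearMap.mulLeft ℂ (w κ g)).comp (cLin κ) := by
      refine LinearMap.pi_ext' fun i => LinearMap.ext_ring ?_
      change cLin κ (g.1.toLin (Pi.single i 1)) * w κ g = w κ g * cLin κ (Pi.single i 1)
      rw [toLin_single, map_smul, cLin_single, cLin_single, w_mul_c]
    exact LinearMap.congr_fun key a
  | mul a b ha hb => rw [map_mul, map_mul, mul_assoc, hb, ← mul_assoc, ha, mul_assoc, map_mul]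
  | add a b ha hb => rw [map_add, map_add, add_mul, ha, hb, map_add, mul_add]

/-- The natural algebra map `K → 𝓗`, with `c_i ↦ c_i` and `g ↦ g`. -/
def ofK : K W →ₐ[ℂ] Alg κ where
  toRingHom := SkewMonoidAlgebra.liftNCRingHom (clHom κ).toRingHom (wHom κ)
    (fun {a g} => clHom_comm κ g a)
  commutes' r := by
    change SkewMonoidAlgebra.liftNC _ _ (SkewMonoidAlgebra.single 1 (algebraMap ℂ (Cl n) r)) = _
    rw [SkewMonoidAlgebra.liftNC_single]
    simp

theorem ofK_c (i : Fin n) : ofK κ (K.c i) = c κ i := by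
  change SkewMonoidAlgebra.liftNC _ _ (SkewMonoidAlgebra.single 1 (clGen i)) = _
  rw [SkewMonoidAlgebra.liftNC_single]
  simp [clGen, clHom_ι, cLin_single]

theorem ofK_w (g : W) : ofK κ (K.w g) = w κ g := by
  change SkewMonoidAlgebra.liftNC _ _ (SkewMonoidAlgebra.single g (1 : Cl n)) = _
  rw [SkewMonoidAlgebra.liftNC_single]
  simp [wHom]

/-! ## The induced module -/

/-- The subalgebra `𝓗_x` of `𝓗` generated by `K` and `x_1, …, x_n`. -/
def Hx : Subalgebra ℂ (Alg κ) := Algebra.adjoin ℂ (Set.range (ofK κ) ∪ Set.range (x κ))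

theorem ofK_mem_Hx (a : K W) : ofK κ a ∈ Hx κ :=
  Algebra.subset_adjoin (Or.inl ⟨a, rfl⟩)

theorem x_mem_Hx (i : Fin n) : x κ i ∈ Hx κ :=
  Algebra.subset_adjoin (Or.inr ⟨i, rfl⟩)

variable {κ}

/-- `ρ` is the extension of the `K`-module `M` to an `𝓗_x`-module on which every `x_i` acts
trivially, i.e. by `0`. -/
def IsTrivialExtension {M : Type*} [AddCommGroup M] [Module ℂ M] [Module (K W) M]
    (ρ : Hx κ →ₐ[ℂ] Module.End ℂ M) : Prop :=
  (∀ (a : K W) (m : M), ρ ⟨ofK κ a, ofK_mem_Hx κ a⟩ m = a • m) ∧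
    ∀ (i : Fin n) (m : M), ρ ⟨x κ i, x_mem_Hx κ i⟩ m = 0

/-- The induced module `A ⊗_S M` of a module `M` over a subalgebra `S` of `A`, the action of `S` on
`M` being `ρ`: the quotient of `A ⊗_ℂ M` by the relations `as ⊗ m = a ⊗ sm`. -/
abbrev Ind {A : Type*} [Ring A] [Algebra ℂ A] {S : Subalgebra ℂ A} {M : Type*} [AddCommGroup M]
    [Module ℂ M] (ρ : S →ₐ[ℂ] Module.End ℂ M) : Type _ :=
  (A ⊗[ℂ] M) ⧸ Submodule.span A
    {z : A ⊗[ℂ] M | ∃ (a : A) (b : S) (m : M), z = (a * (b : A)) ⊗ₜ[ℂ] m - a ⊗ₜ[ℂ] ρ b m}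

variable (κ)

open scoped IsMulCommutative in
/-- The algebra map `ℂ[y_1, …, y_n] → 𝓗`, `f ↦ f(y_1, …, y_n)`; it is evaluation in the commutative
subalgebra generated by the `y_i`. -/
def polyY : MvPolynomial (Fin n) ℂ →ₐ[ℂ] Alg κ :=
  have : IsMulCommutative (Algebra.adjoin ℂ (Set.range (y κ))) :=
    Algebra.isMulCommutative_adjoin ℂ (by
      rintro _ ⟨i, rfl⟩ _ ⟨j, rfl⟩
      exact y_mul_comm κ i j)
  (Algebra.adjoin ℂ (Set.range (y κ))).val.comp
    (MvPolynomial.aeval fun i => ⟨y κ i, Algebra.subset_adjoin ⟨i, rfl⟩⟩)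

theorem polyY_X (i : Fin n) : polyY κ (MvPolynomial.X i) = y κ i := by
  simp [polyY]

variable {κ}

/-- The linear map `ℂ[y_1, …, y_n] ⊗ M → Ind M`, `f ⊗ m ↦ f(y) ⊗ m`, along which the two spaces
are identified. -/
def ident {M : Type*} [AddCommGroup M] [Module ℂ M] (ρ : Hx κ →ₐ[ℂ] Module.End ℂ M) :
    MvPolynomial (Fin n) ℂ ⊗[ℂ] M →ₗ[ℂ] Ind ρ :=
  ((Submodule.mkQ _).restrictScalars ℂ).comp ((polyY κ).toLinearMap.rTensor M)

theorem ident_tmul {M : Type*} [AddCommGroup M] [Module ℂ M] (ρ : Hx κ →ₐ[ℂ] Module.End ℂ M)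
    (f : MvPolynomial (Fin n) ℂ) (m : M) :
    ident ρ (f ⊗ₜ m) = Submodule.Quotient.mk (polyY κ f ⊗ₜ[ℂ] m) := rfl

/-! ## Divided differences -/

open Classical in
/-- The exact quotient `p / d` of polynomials: the polynomial `q` with `p = d q` (unique if
`d ≠ 0`). It is applied only where `d ≠ 0` divides `p`; see the three divisibility facts below. -/
def exactDiv (p d : MvPolynomial (Fin n) ℂ) : MvPolynomial (Fin n) ℂ :=
  if h : d ∣ p then h.choose else 0

theorem mul_exactDiv {p d : MvPolynomial (Fin n) ℂ} (h : d ∣ p) : d * exactDiv p d = p := by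
  rw [exactDiv, dif_pos h]
  exact h.choose_spec.symm

theorem dvd_sub_actPoly (g : SignedPerm n) (d : MvPolynomial (Fin n) ℂ)
    (h : ∀ j, d ∣ MvPolynomial.X j - g.actPoly (MvPolynomial.X j))
    (f : MvPolynomial (Fin n) ℂ) : d ∣ f - g.actPoly f := by
  have key : Ideal.Quotient.mkₐ ℂ (Ideal.span {d})
      = (Ideal.Quotient.mkₐ ℂ (Ideal.span {d})).comp g.actPoly := by
    refine MvPolynomial.algHom_ext fun j => ?_
    exact Ideal.Quotient.eq.2 (Ideal.mem_span_singleton.2 (h j))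
  exact Ideal.mem_span_singleton.1 (Ideal.Quotient.eq.1 (DFunLike.congr_fun key f))

theorem dvd_s (k i : Fin n) (f : MvPolynomial (Fin n) ℂ) :
    (MvPolynomial.X i - MvPolynomial.X k : MvPolynomial (Fin n) ℂ) ∣ f - (s k i).actPoly f := by
  refine dvd_sub_actPoly _ _ (fun j => ?_) f
  by_cases hk : j = k
  · subst hk
    exact ⟨-1, by simp [actPoly, s]⟩
  by_cases hi : j = i
  · subst hi
    exact ⟨1, by simp [actPoly, s]⟩
  · simp [actPoly, s, Equiv.swap_apply_of_ne_of_ne hk hi]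

theorem dvd_sbar {k i : Fin n} (hki : k ≠ i) (f : MvPolynomial (Fin n) ℂ) :
    (MvPolynomial.X i + MvPolynomial.X k : MvPolynomial (Fin n) ℂ) ∣ f - (sbar k i).actPoly f := by
  refine dvd_sub_actPoly _ _ (fun j => ?_) f
  by_cases hk : j = k
  · subst hk
    exact ⟨1, by simp [actPoly, sbar, hki]; ring⟩
  by_cases hi : j = i
  · subst hi
    exact ⟨1, by simp [actPoly, sbar, hki.symm]⟩
  · simp [actPoly, sbar, hk, hi, Equiv.swap_apply_of_ne_of_ne hk hi]

theorem dvd_tau (i : Fin n) (f : MvPolynomial (Fin n) ℂ) :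
    (2 * MvPolynomial.X i : MvPolynomial (Fin n) ℂ) ∣ f - (tau i).actPoly f := by
  refine dvd_sub_actPoly _ _ (fun j => ?_) f
  by_cases hi : j = i
  · subst hi
    exact ⟨1, by simp [actPoly, tau]; ring⟩
  · simp [actPoly, tau, hi]

end DaHCa

end

/-! The formula for `x_i` is forced: `x_i` kills `1 ⊗ M`, and moving it past each `y_k` by means of
`[y_k, x_i]` determines it on `f ⊗ m`. The real content is that nothing collapses in the quotient.
This is shown without a PBW theorem, by building a representation of the algebra on `ℂ[y] ⊗ M` from
the expected operators (`opGen`) and checking the defining relations (`opFree_rel`).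

Most relations are direct. The commutators `[y_j, x_i]` come from the twisted Leibniz rule of
divided differences. The relations with the `c_j` hold because the Clifford factor in `(1 + σ c_k
c_i) r` cancels the permutation of the `c`'s by the reflection `r`. The hard relation is `x_i x_j =
x_j x_i`. By the Jacobi identity, `[x_i, x_j]` commutes with every `y_k` as soon as `[[y_k, x_i],
x_j] = [[y_k, x_j], x_i]` (`kappa_bracket_x`). It also kills `1 ⊗ M`, which generates the space
under the `y_k`, so it vanishes.

Once the algebra acts, `1 ⊗ M` is stable under `𝓗_x` and carries the trivial extension; `one_tmul`
compares any trivial extension with this action and so gives uniqueness. The map `a ⊗ m ↦ a (1 ⊗ m)`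
respects the tensor relations and gives a left inverse of `ident`. Conversely `ident` intertwines
the operators with the action on the induced module (`smul_ident`), which gives both surjectivity
and the formula for `x_i`.

The three types are treated at once: `W` is any group of signed permutations, a sign `σ`
distinguishes `s` from `s̄`, and reflections outside `W` are replaced by `0`. -/

noncomputable section

namespace DaHCa

open SignedPerm

/-! ### Reflections and sign changes under conjugation -/

namespace SignedPerm

variable {n : ℕ}

/-- The reflection `e_i ↦ σ e_k`, `e_k ↦ σ e_i` (for `i ≠ k`), where `σ = ±1`. -/
def refl (k i : Fin n) (σ : ℤˣ) : SignedPerm n :=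
  ⟨Equiv.swap k i, fun l => (if l = k then σ else 1) * (if l = i then σ else 1)⟩

theorem refl_one (k i : Fin n) : refl k i 1 = s k i := by
  ext l <;> simp [refl, s]

theorem refl_neg_one (k i : Fin n) : refl k i (-1) = sbar k i := rfl

theorem refl_comm (k i : Fin n) (σ : ℤˣ) : refl k i σ = refl i k σ := by
  ext l
  · simp [refl, Equiv.swap_comm]
  · simp [refl, mul_comm]

theorem refl_perm_left (k i : Fin n) (σ : ℤˣ) : (refl k i σ).perm k = i := by simp [refl]

theorem refl_perm_right (k i : Fin n) (σ : ℤˣ) : (refl k i σ).perm i = k := by simp [refl]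

theorem refl_perm_of_ne {k i l : Fin n} (hk : l ≠ k) (hi : l ≠ i) (σ : ℤˣ) :
    (refl k i σ).perm l = l := by simp [refl, Equiv.swap_apply_of_ne_of_ne hk hi]

theorem refl_sign_left {k i : Fin n} (h : k ≠ i) (σ : ℤˣ) : (refl k i σ).sign k = σ := by
  simp [refl, h]

theorem refl_sign_right {k i : Fin n} (h : k ≠ i) (σ : ℤˣ) : (refl k i σ).sign i = σ := by
  simp [refl, h.symm]

theorem refl_sign_of_ne {k i l : Fin n} (hk : l ≠ k) (hi : l ≠ i) (σ : ℤˣ) :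
    (refl k i σ).sign l = 1 := by simp [refl, hk, hi]

/-- Conjugation carries the reflection in `e_i - σ e_k` to the reflection in the image of that
vector under `g`, which up to the factor `g.sign i` is again of this form, with `σ` multiplied by
both signs. -/
theorem mul_refl (g : SignedPerm n) {k i : Fin n} (h : k ≠ i) (σ : ℤˣ) :
    g * refl k i σ = refl (g.perm k) (g.perm i) (σ * (g.sign k * g.sign i)) * g := by
  ext l
  · simp only [mul_perm, Equiv.Perm.mul_apply]
    by_cases hk : l = k
    · subst hk; simp [refl_perm_left]
    by_cases hi : l = i
    · subst hi; simp [refl_perm_right]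
    rw [refl_perm_of_ne hk hi, refl_perm_of_ne (g.perm.injective.ne hk) (g.perm.injective.ne hi)]
  · congr 1
    simp only [mul_sign]
    by_cases hk : l = k
    · subst hk
      rw [refl_perm_left, refl_sign_left h, refl_sign_left (g.perm.injective.ne h),
        mul_assoc, mul_right_comm, ← mul_assoc, Int.units_mul_self]
      simp [mul_comm]
    by_cases hi : l = i
    · subst hi
      rw [refl_perm_right, refl_sign_right h, refl_sign_right (g.perm.injective.ne h),
        mul_assoc, mul_assoc, Int.units_mul_self]
      simp [mul_comm]
    rw [refl_perm_of_ne hk hi, refl_sign_of_ne hk hi,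
      refl_sign_of_ne (g.perm.injective.ne hk) (g.perm.injective.ne hi)]
    simp

theorem tau_perm (i l : Fin n) : (tau i).perm l = l := rfl

theorem tau_sign_self (i : Fin n) : (tau i).sign i = -1 := by simp [tau]

theorem tau_sign_of_ne {i l : Fin n} (h : l ≠ i) : (tau i).sign l = 1 := by simp [tau, h]

theorem mul_tau (g : SignedPerm n) (i : Fin n) : g * tau i = tau (g.perm i) * g := by
  ext l
  · simp [tau]
  · simp [tau, mul_comm]

theorem actPoly_X (g : SignedPerm n) (i : Fin n) :
    g.actPoly (MvPolynomial.X i) = ((g.sign i : ℤ) : ℂ) • MvPolynomial.X (g.perm i) := by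
  simp [actPoly]

theorem actPoly_mul (g h : SignedPerm n) : (g * h).actPoly = g.actPoly.comp h.actPoly := by
  refine MvPolynomial.algHom_ext fun i => ?_
  simp [actPoly_X, smul_smul, mul_comm]

theorem actPoly_one : (1 : SignedPerm n).actPoly = AlgHom.id ℂ _ := by
  refine MvPolynomial.algHom_ext fun i => ?_
  simp [actPoly_X]

end SignedPerm

variable {n : ℕ} {W : Subgroup (SignedPerm n)}

theorem sign_mul_self (σ : ℤˣ) : ((σ : ℤ) : ℂ) * ((σ : ℤ) : ℂ) = 1 := by
  rcases Int.units_eq_one_or σ with h | h <;> simp [h]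

/-! ### Relations in `K` -/

namespace K

theorem w_one : K.w (1 : W) = 1 := map_one _

theorem w_mul (g h : W) : K.w (g * h) = K.w g * K.w h := map_mul _ _ _

theorem c_mul_self (i : Fin n) : (K.c i : K W) * K.c i = 1 := by
  simp only [K.c, SkewMonoidAlgebra.single_mul_single, one_smul, mul_one, clGen,
    CliffordAlgebra.ι_sq_scalar, stdForm_apply]
  simp [Pi.single_apply]

theorem c_mul_anti {i j : Fin n} (h : i ≠ j) : (K.c i : K W) * K.c j = -(K.c j * K.c i) := by
  simp only [K.c, SkewMonoidAlgebra.single_mul_single, one_smul, mul_one, clGen]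
  rw [← SkewMonoidAlgebra.single_neg]
  congr 1
  rw [eq_neg_iff_add_eq_zero, CliffordAlgebra.ι_mul_ι_add_swap, QuadraticMap.polar,
    stdForm_apply, stdForm_apply, stdForm_apply]
  -- The polar form vanishes on `(e_i, e_j)`: no coordinate is nonzero in both vectors, so there are
  -- no cross terms.
  have : ∑ x, ((Pi.single i 1 + Pi.single j 1 : Fin n → ℂ) x)
      * (Pi.single i 1 + Pi.single j 1 : Fin n → ℂ) x
      = ∑ x, (Pi.single i 1 : Fin n → ℂ) x * (Pi.single i 1 : Fin n → ℂ) x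
        + ∑ x, (Pi.single j 1 : Fin n → ℂ) x * (Pi.single j 1 : Fin n → ℂ) x := by
    rw [← Finset.sum_add_distrib]
    refine Finset.sum_congr rfl fun x _ => ?_
    by_cases hi : x = i
    · subst hi; simp [h]
    · simp [hi]
  rw [this]
  simp

theorem w_mul_c (g : W) (i : Fin n) :
    K.w g * K.c i = ((g.1.sign i : ℤ) : ℂ) • (K.c (g.1.perm i) * K.w g) := by
  have : g • clGen i = ((g.1.sign i : ℤ) : ℂ) • clGen (n := n) (g.1.perm i) := by
    change CliffordAlgebra.map (isom g.1) _ = _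
    rw [clGen, CliffordAlgebra.map_apply_ι, clGen, ← map_smul]
    congr 1
    exact toLin_single g.1 i
  change SkewMonoidAlgebra.single g (1 : Cl n) * SkewMonoidAlgebra.single 1 (clGen i)
    = _ • (SkewMonoidAlgebra.single 1 (clGen _) * SkewMonoidAlgebra.single g (1 : Cl n))
  rw [SkewMonoidAlgebra.single_mul_single, SkewMonoidAlgebra.single_mul_single, this,
    SkewMonoidAlgebra.smul_single]
  simp

/-- `K` is generated by the `c_i` and `W`. -/
theorem adjoin_eq_top :
    Algebra.adjoin ℂ (Set.range (K.c (W := W)) ∪ Set.range (K.w (W := W))) = ⊤ := by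
  set S := Algebra.adjoin ℂ (Set.range (K.c (W := W)) ∪ Set.range (K.w (W := W))) with hS
  have hc (a : Cl n) : SkewMonoidAlgebra.single (1 : W) a ∈ S := by
    induction a using CliffordAlgebra.induction with
    | algebraMap r => exact S.algebraMap_mem r
    | ι a =>
      have : SkewMonoidAlgebra.single (1 : W) (CliffordAlgebra.ι (stdForm n) a)
          = ∑ i, a i • (K.c i : K W) := by
        conv_lhs => rw [pi_eq_sum_univ' a]
        simp only [K.c, clGen, SkewMonoidAlgebra.smul_single, ← map_smul, map_sum]
        have hsum := map_sum (AddMonoidHom.mk' (SkewMonoidAlgebra.single (1 : W))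
          (fun a b : Cl n => SkewMonoidAlgebra.single_add (1 : W) a b))
          (fun i => CliffordAlgebra.ι (stdForm n) (a i • (Pi.single i 1 : Fin n → ℂ)))
          Finset.univ
        refine Eq.trans ?_ hsum
        simp only [AddMonoidHom.mk'_apply]
      rw [this]
      exact S.sum_mem fun i _ => S.smul_mem (Algebra.subset_adjoin (Or.inl ⟨i, rfl⟩)) _
    | mul a b ha hb =>
      have := S.mul_mem ha hb
      simpa [SkewMonoidAlgebra.single_mul_single] using this
    | add a b ha hb =>
      rw [SkewMonoidAlgebra.single_add]
      exact S.add_mem ha hb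
  rw [eq_top_iff]
  rintro a -
  induction a using SkewMonoidAlgebra.induction_on with
  | zero => exact S.zero_mem
  | single g a =>
    have := S.mul_mem (hc a) (Algebra.subset_adjoin (Or.inr ⟨g, rfl⟩) : K.w g ∈ S)
    have e : SkewMonoidAlgebra.single (1 : W) a * K.w g = SkewMonoidAlgebra.single g a := by
      change SkewMonoidAlgebra.single (1 : W) a * SkewMonoidAlgebra.single g (1 : Cl n) = _
      simp [SkewMonoidAlgebra.single_mul_single]
    rwa [e] at this
  | add a b ha hb => exact S.add_mem ha hb

open Classical in
/-- The element `g` of `K` if `g ∈ W`, and `0` otherwise. -/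
def el (W : Subgroup (SignedPerm n)) (g : SignedPerm n) : K W :=
  if h : g ∈ W then K.w ⟨g, h⟩ else 0

theorem el_of_mem {g : SignedPerm n} (h : g ∈ W) : el W g = K.w ⟨g, h⟩ := dif_pos h

theorem el_of_notMem {g : SignedPerm n} (h : g ∉ W) : el W g = 0 := dif_neg h

theorem el_mul_c (g : SignedPerm n) (i : Fin n) :
    el W g * K.c i = ((g.sign i : ℤ) : ℂ) • (K.c (g.perm i) * el W g) := by
  by_cases h : g ∈ W
  · rw [el_of_mem h, w_mul_c]
  · simp [el_of_notMem h]

/-- Conjugation by `g ∈ W` preserves both `W` and its complement, so replacing elements outside `W`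
by `0` is compatible with conjugation. -/
theorem w_mul_el (g : W) {h h' : SignedPerm n} (e : g.1 * h = h' * g.1) :
    K.w g * el W h = el W h' * K.w g := by
  by_cases hh : h ∈ W
  · have hh' : h' ∈ W := by
      rw [← mul_inv_eq_iff_eq_mul.2 e]
      exact W.mul_mem (W.mul_mem g.2 hh) (W.inv_mem g.2)
    rw [el_of_mem hh, el_of_mem hh', ← w_mul, ← w_mul]
    exact congrArg _ (Subtype.ext e)
  · have hh' : h' ∉ W := fun hh' => hh <| by
      rw [← inv_mul_eq_iff_eq_mul.2 e.symm]
      exact W.mul_mem (W.inv_mem g.2) (W.mul_mem hh' g.2)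
    rw [el_of_notMem hh, el_of_notMem hh', mul_zero, zero_mul]

/-- The element `(1 + σ c_k c_i) r` of `K`, where `r` is the reflection `e_i ↦ σ e_k`. -/
def reflEl (W : Subgroup (SignedPerm n)) (k i : Fin n) (σ : ℤˣ) : K W :=
  (1 + ((σ : ℤ) : ℂ) • (K.c k * K.c i)) * el W (refl k i σ)

end K
end DaHCa
end

noncomputable section

namespace DaHCa

open SignedPerm

variable {n : ℕ} {W : Subgroup (SignedPerm n)}

/-! ### Clifford identities for the factor `1 + σ c_k c_i` -/

section Anticommuting

variable {A : Type*} [Ring A] [Algebra ℂ A] {a b : A}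

/-- Applied with `a = c_k`, `b = c_i`, `t = σ`. The reflection turns `c_i` into `σ c_k`; this
identity turns `σ c_k` back into `-c_i`. The next two lemmas do the same for `c_k` and for the
remaining `c_j`. -/
theorem one_add_smul_mul_left (ha : a * a = 1) (hab : a * b = -(b * a))
    (hb : b * b = 1) {t : ℂ} (ht : t * t = 1) :
    (1 + t • (a * b)) * (t • a) = -(b * (1 + t • (a * b))) := by
  have h1 : a * b * a = -b := by rw [hab, neg_mul, mul_assoc, ha, mul_one]
  have h2 : b * (a * b) = -a := by rw [hab, mul_neg, ← mul_assoc, hb, one_mul]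
  rw [add_mul, smul_mul_smul_comm, ht, h1]
  simp only [one_mul, one_smul, mul_one, mul_add, mul_smul_comm, h2, smul_neg]
  abel

theorem one_add_smul_mul_right (ha : a * a = 1)
    (hb : b * b = 1) {t : ℂ} (ht : t * t = 1) :
    (1 + t • (a * b)) * (t • b) = a * (1 + t • (a * b)) := by
  have h1 : a * (a * b) = b := by rw [← mul_assoc, ha, one_mul]
  rw [add_mul, smul_mul_smul_comm, ht, mul_assoc, hb]
  simp only [one_mul, one_smul, mul_one, mul_add, mul_smul_comm, h1]
  abel

theorem one_add_smul_mul_comm {z : A} (ha : z * a = -(a * z)) (hb : z * b = -(b * z)) (t : ℂ) :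
    (1 + t • (a * b)) * z = z * (1 + t • (a * b)) := by
  have : z * (a * b) = a * b * z := by
    rw [← mul_assoc, ha, neg_mul, mul_assoc, hb, mul_neg, neg_neg, mul_assoc]
  rw [add_mul, mul_add, mul_smul_comm, this, smul_mul_assoc, one_mul, mul_one]

end Anticommuting

/-! ### Commutation of the reflection elements of `K` with the `c_j` and with `W` -/

namespace K

/-- Together with `reflEl_mul_c`, this says that `reflEl W k i σ` has the same commutation rules
with the `c_j` as `x_i` does, although the reflection alone permutes them. -/
theorem reflEl_mul_c_self {k i : Fin n} (h : k ≠ i) (σ : ℤˣ) :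
    reflEl W k i σ * K.c i = -(K.c i * reflEl W k i σ) := by
  rw [reflEl, mul_assoc, el_mul_c, refl_perm_right, refl_sign_right h,
    ← smul_mul_assoc _ (K.c k) (el W _),
    ← mul_assoc, one_add_smul_mul_left (c_mul_self k) (c_mul_anti h) (c_mul_self i)
      (sign_mul_self σ), neg_mul, mul_assoc]

theorem reflEl_mul_c {k i j : Fin n} (h : k ≠ i) (hj : j ≠ i) (σ : ℤˣ) :
    reflEl W k i σ * K.c j = K.c j * reflEl W k i σ := by
  rw [reflEl, mul_assoc, el_mul_c, ← smul_mul_assoc _ (K.c _) (el W _), ← mul_assoc, ← mul_assoc]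
  congr 1
  by_cases hk : j = k
  · subst hk
    rw [refl_perm_left, refl_sign_left h,
      one_add_smul_mul_right (c_mul_self j) (c_mul_self i) (sign_mul_self σ)]
  · rw [refl_perm_of_ne hk hj, refl_sign_of_ne hk hj, Units.val_one, Int.cast_one, one_smul,
      one_add_smul_mul_comm (c_mul_anti hk) (c_mul_anti hj)]

theorem w_mul_reflEl (g : W) {k i : Fin n} (h : k ≠ i) (σ : ℤˣ) :
    K.w g * reflEl W k i σ
      = reflEl W (g.1.perm k) (g.1.perm i) (σ * (g.1.sign k * g.1.sign i)) * K.w g := by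
  have e : K.w g * (1 + ((σ : ℤ) : ℂ) • (K.c k * K.c i))
      = (1 + (((σ * (g.1.sign k * g.1.sign i) : ℤˣ) : ℤ) : ℂ) •
          (K.c (g.1.perm k) * K.c (g.1.perm i))) * K.w g := by
    rw [mul_add, add_mul, mul_one, one_mul, mul_smul_comm, ← mul_assoc, w_mul_c, smul_mul_assoc,
      mul_assoc, w_mul_c, mul_smul_comm, smul_mul_assoc, mul_assoc, smul_smul, smul_smul]
    push_cast
    rw [mul_assoc]
  rw [reflEl, ← mul_assoc, e, mul_assoc, w_mul_el g (mul_refl g.1 h σ), ← mul_assoc, reflEl]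

theorem el_tau_mul_c_self (i : Fin n) :
    el W (tau i) * K.c i = -(K.c i * el W (tau i)) := by
  simp [el_mul_c, tau_sign_self, tau_perm]

theorem el_tau_mul_c {i j : Fin n} (h : j ≠ i) :
    el W (tau i) * K.c j = K.c j * el W (tau i) := by
  simp [el_mul_c, tau_sign_of_ne h, tau_perm]

theorem w_mul_el_tau (g : W) (i : Fin n) :
    K.w g * el W (tau i) = el W (tau (g.1.perm i)) * K.w g :=
  w_mul_el g (mul_tau g.1 i)

end K

/-! ### Divided differences as linear maps -/

section DividedDifference

open MvPolynomial

/-- Cancellation in a domain makes the quotient unique, so identities between divided differences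
can be checked after multiplication by `d`. -/
theorem exactDiv_eq {p d q : MvPolynomial (Fin n) ℂ} (hd : d ≠ 0) (h : p = d * q) :
    exactDiv p d = q :=
  mul_left_cancel₀ hd (by rw [mul_exactDiv ⟨q, h⟩, h])

/-- The divided difference `f ↦ (f - f^g) / d`, where `d ≠ 0` divides every `f - f^g`. -/
def divDiff (g : SignedPerm n) (d : MvPolynomial (Fin n) ℂ) (hd : d ≠ 0)
    (h : ∀ f, d ∣ f - g.actPoly f) : MvPolynomial (Fin n) ℂ →ₗ[ℂ] MvPolynomial (Fin n) ℂ where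
  toFun f := exactDiv (f - g.actPoly f) d
  map_add' f f' := exactDiv_eq hd <| by
    rw [mul_add, mul_exactDiv (h f), mul_exactDiv (h f'), map_add]
    abel
  map_smul' r f := exactDiv_eq hd <| by
    rw [RingHom.id_apply, mul_smul_comm, mul_exactDiv (h f), map_smul, smul_sub]

/-- The linear form `y_i - σ y_k` defining the reflection `refl k i σ`. -/
def reflForm (k i : Fin n) (σ : ℤˣ) : MvPolynomial (Fin n) ℂ := X i - ((σ : ℤ) : ℂ) • X k

theorem reflForm_ne_zero {k i : Fin n} (h : k ≠ i) (σ : ℤˣ) : reflForm k i σ ≠ 0 := by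
  intro e
  -- At the point `e_i` the form takes the value `1`, since `k ≠ i`.
  have := congrArg (eval (Pi.single i 1 : Fin n → ℂ)) e
  simp [reflForm, smul_eval, h] at this

theorem reflForm_one (k i : Fin n) : reflForm k i 1 = X i - X k := by simp [reflForm]

theorem reflForm_neg_one (k i : Fin n) : reflForm k i (-1) = X i + X k := by simp [reflForm]

theorem reflForm_dvd {k i : Fin n} (h : k ≠ i) (σ : ℤˣ) (f : MvPolynomial (Fin n) ℂ) :
    reflForm k i σ ∣ f - (refl k i σ).actPoly f := by
  rcases Int.units_eq_one_or σ with rfl | rfl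
  · rw [reflForm_one, refl_one]; exact dvd_s k i f
  · rw [reflForm_neg_one, refl_neg_one]; exact dvd_sbar h f

open Classical in
/-- The divided difference `f ↦ (f - f^r) / (y_i - σ y_k)`, where `r` is the reflection
`e_i ↦ σ e_k`; it is `0` if `k = i`. -/
def reflDiff (k i : Fin n) (σ : ℤˣ) : MvPolynomial (Fin n) ℂ →ₗ[ℂ] MvPolynomial (Fin n) ℂ :=
  if h : k ≠ i then
    divDiff (refl k i σ) (reflForm k i σ) (reflForm_ne_zero h σ) (reflForm_dvd h σ)
  else 0

theorem reflDiff_apply {k i : Fin n} (h : k ≠ i) (σ : ℤˣ) (f : MvPolynomial (Fin n) ℂ) :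
    reflDiff k i σ f = exactDiv (f - (refl k i σ).actPoly f) (reflForm k i σ) := by
  rw [reflDiff, dif_pos h]; rfl

theorem reflDiff_eq {k i : Fin n} (h : k ≠ i) {σ : ℤˣ} {f q : MvPolynomial (Fin n) ℂ}
    (e : f - (refl k i σ).actPoly f = reflForm k i σ * q) : reflDiff k i σ f = q := by
  rw [reflDiff_apply h]
  exact exactDiv_eq (reflForm_ne_zero h σ) e

theorem mul_reflDiff {k i : Fin n} (h : k ≠ i) (σ : ℤˣ) (f : MvPolynomial (Fin n) ℂ) :
    reflForm k i σ * reflDiff k i σ f = f - (refl k i σ).actPoly f := by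
  rw [reflDiff_apply h]
  exact mul_exactDiv (reflForm_dvd h σ f)

theorem reflDiff_one (k i : Fin n) (σ : ℤˣ) : reflDiff k i σ 1 = 0 := by
  by_cases h : k ≠ i
  · exact reflDiff_eq h (by simp)
  · rw [reflDiff, dif_neg h]; rfl

/-- A case of the twisted Leibniz rule `Δ(p f) = p Δ(f) + Δ(p) f^r`, with `Δ(y_i) = 1`. The next two
lemmas are the cases `Δ(y_k) = -σ` and `Δ(y_j) = 0`. The terms in `f^r` produce the commutators
`[y_j, x_i]`. -/
theorem reflDiff_X_self_mul {k i : Fin n} (h : k ≠ i) (σ : ℤˣ) (f : MvPolynomial (Fin n) ℂ) :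
    reflDiff k i σ (X i * f) = X i * reflDiff k i σ f + (refl k i σ).actPoly f := by
  refine reflDiff_eq h ?_
  rw [mul_add, mul_left_comm, mul_reflDiff h, map_mul, actPoly_X, refl_perm_right,
    refl_sign_right h, reflForm]
  ring

theorem reflDiff_X_left_mul {k i : Fin n} (h : k ≠ i) (σ : ℤˣ) (f : MvPolynomial (Fin n) ℂ) :
    reflDiff k i σ (X k * f)
      = X k * reflDiff k i σ f - ((σ : ℤ) : ℂ) • (refl k i σ).actPoly f := by
  refine reflDiff_eq h ?_
  rw [mul_sub, mul_left_comm, mul_reflDiff h, map_mul, actPoly_X, refl_perm_left,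
    refl_sign_left h, reflForm]
  simp only [sub_mul, mul_sub, smul_mul_assoc, mul_smul_comm, smul_sub, smul_smul, sign_mul_self,
    one_smul]
  ring

theorem reflDiff_X_mul_of_ne {k i j : Fin n} (h : k ≠ i) (hk : j ≠ k) (hi : j ≠ i) (σ : ℤˣ)
    (f : MvPolynomial (Fin n) ℂ) :
    reflDiff k i σ (X j * f) = X j * reflDiff k i σ f := by
  refine reflDiff_eq h ?_
  rw [mul_left_comm, mul_reflDiff h, map_mul, actPoly_X, refl_perm_of_ne hk hi,
    refl_sign_of_ne hk hi]
  simp [mul_sub]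

/-- The automorphism `g` carries `y_i - σ y_k` to `g.sign i` times the form of the conjugate
reflection; that sign is the scalar on the right. -/
theorem actPoly_reflDiff (g : SignedPerm n) {k i : Fin n} (h : k ≠ i) (σ : ℤˣ)
    (f : MvPolynomial (Fin n) ℂ) :
    g.actPoly (reflDiff k i σ f) = ((g.sign i : ℤ) : ℂ) •
      reflDiff (g.perm k) (g.perm i) (σ * (g.sign k * g.sign i)) (g.actPoly f) := by
  have h' : g.perm k ≠ g.perm i := g.perm.injective.ne h
  rw [← map_smul]
  refine (reflDiff_eq h' ?_).symm
  rw [map_smul, ← AlgHom.comp_apply, ← actPoly_mul, ← mul_refl g h, actPoly_mul,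
    AlgHom.comp_apply, ← smul_sub, ← map_sub, ← mul_reflDiff h, map_mul, ← smul_mul_assoc]
  congr 1
  simp only [reflForm, map_sub, map_smul, actPoly_X, smul_sub, smul_smul, sign_mul_self, one_smul]
  congr 2
  push_cast
  ring

theorem two_mul_X_ne_zero (i : Fin n) : (2 * X i : MvPolynomial (Fin n) ℂ) ≠ 0 :=
  mul_ne_zero two_ne_zero (X_ne_zero i)

/-- The divided difference `f ↦ (f - f^τ) / 2y_i`, where `τ` is the sign change at `i`. -/
def tauDiff (i : Fin n) : MvPolynomial (Fin n) ℂ →ₗ[ℂ] MvPolynomial (Fin n) ℂ :=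
  divDiff (tau i) (2 * X i) (two_mul_X_ne_zero i) (dvd_tau i)

theorem tauDiff_eq {i : Fin n} {f q : MvPolynomial (Fin n) ℂ}
    (e : f - (tau i).actPoly f = 2 * X i * q) : tauDiff i f = q :=
  exactDiv_eq (two_mul_X_ne_zero i) e

theorem mul_tauDiff (i : Fin n) (f : MvPolynomial (Fin n) ℂ) :
    2 * X i * tauDiff i f = f - (tau i).actPoly f :=
  mul_exactDiv (dvd_tau i f)

theorem tauDiff_one (i : Fin n) : tauDiff i 1 = 0 := tauDiff_eq (by simp)

theorem tauDiff_X_self_mul (i : Fin n) (f : MvPolynomial (Fin n) ℂ) :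
    tauDiff i (X i * f) = X i * tauDiff i f + (tau i).actPoly f := by
  refine tauDiff_eq ?_
  rw [mul_add, mul_left_comm, mul_tauDiff, map_mul, actPoly_X, tau_perm, tau_sign_self]
  simp only [Units.val_neg, Units.val_one, Int.cast_neg, Int.cast_one, neg_smul, one_smul]
  ring

theorem tauDiff_X_mul_of_ne {i j : Fin n} (h : j ≠ i) (f : MvPolynomial (Fin n) ℂ) :
    tauDiff i (X j * f) = X j * tauDiff i f := by
  refine tauDiff_eq ?_
  rw [mul_left_comm, mul_tauDiff, map_mul, actPoly_X, tau_perm, tau_sign_of_ne h]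
  simp [mul_sub]

theorem actPoly_tauDiff (g : SignedPerm n) (i : Fin n) (f : MvPolynomial (Fin n) ℂ) :
    g.actPoly (tauDiff i f) = ((g.sign i : ℤ) : ℂ) • tauDiff (g.perm i) (g.actPoly f) := by
  rw [← map_smul]
  refine (tauDiff_eq ?_).symm
  rw [map_smul, ← AlgHom.comp_apply, ← actPoly_mul, ← mul_tau, actPoly_mul,
    AlgHom.comp_apply, ← smul_sub, ← map_sub, ← mul_tauDiff, map_mul, map_mul, actPoly_X,
    ← smul_mul_assoc, mul_smul_comm, smul_smul, sign_mul_self, one_smul, map_ofNat]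

end DividedDifference

end DaHCa
end

noncomputable section

namespace DaHCa

open SignedPerm

variable {n : ℕ} {W : Subgroup (SignedPerm n)}

/-! ### The commutators `[y_j, x_i]` in a uniform way -/

open Classical in
/-- The generator `g` of the free algebra if `g ∈ W`, and `0` otherwise. -/
def freeEl (W : Subgroup (SignedPerm n)) (g : SignedPerm n) : Free W :=
  if h : g ∈ W then gen (.w ⟨g, h⟩) else 0

theorem freeEl_of_mem {g : SignedPerm n} (h : g ∈ W) : freeEl W g = gen (.w ⟨g, h⟩) := dif_pos h

theorem freeEl_of_notMem {g : SignedPerm n} (h : g ∉ W) : freeEl W g = 0 := dif_neg h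

/-- The element `(1 + σ c_k c_i) r` of the free algebra, where `r` is the reflection
`e_i ↦ σ e_k`. -/
def freeReflEl (W : Subgroup (SignedPerm n)) (k i : Fin n) (σ : ℤˣ) : Free W :=
  (1 + ((σ : ℤ) : ℂ) • (gen (.c k) * gen (.c i))) * freeEl W (refl k i σ)

/-- The commutators `[y_j, x_i]` for an arbitrary group `W` of signed permutations: the reflections
that are not in `W` do not contribute. -/
def kappa (W : Subgroup (SignedPerm n)) (u v : ℂ) (j i : Fin n) : Free W :=
  if i ≠ j then u • ∑ σ : ℤˣ, ((σ : ℤ) : ℂ) • freeReflEl W j i σ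
  else -(u • ∑ k ∈ Finset.univ.erase i, ∑ σ : ℤˣ, freeReflEl W k i σ) - v • freeEl W (tau i)

theorem kappa_of_ne {u v : ℂ} {j i : Fin n} (h : i ≠ j) :
    kappa W u v j i = u • ∑ σ : ℤˣ, ((σ : ℤ) : ℂ) • freeReflEl W j i σ := if_pos h

theorem kappa_self (u v : ℂ) (i : Fin n) :
    kappa W u v i i = -(u • ∑ k ∈ Finset.univ.erase i, ∑ σ : ℤˣ, freeReflEl W k i σ)
      - v • freeEl W (tau i) := if_neg (by simp)

/-! ### The Jacobi identity for `x_i, x_j, y_k` -/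

section Jacobi

/-- The Jacobi identity `[y, [x, z]] = [[y, x], z] - [[y, z], x]`. -/
theorem commutator_commute_of_bracket_eq {A : Type*} [Ring A] {x z y : A}
    (h : (y * x - x * y) * z - z * (y * x - x * y) = (y * z - z * y) * x - x * (y * z - z * y)) :
    (x * z - z * x) * y = y * (x * z - z * x) := by
  rw [← sub_eq_zero] at h ⊢
  rw [← neg_eq_zero, ← h]
  simp only [sub_mul, mul_sub, mul_assoc]
  abel

variable {A : Type*} [Ring A] [Algebra ℂ A] {F : Free W →ₐ[ℂ] A}

/-- Here and below, the relations assumed of `F` do not include the commutativity of the `x_i`, so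
the results apply to the operators while that relation is still to be proved. -/
theorem freeEl_mul_x
    (hwx : ∀ (g : W) (i : Fin n), F (gen (.w g)) * F (gen (.x i))
      = ((g.1.sign i : ℤ) : ℂ) • (F (gen (.x (g.1.perm i))) * F (gen (.w g))))
    (g : SignedPerm n) (i : Fin n) :
    F (freeEl W g) * F (gen (.x i))
      = ((g.sign i : ℤ) : ℂ) • (F (gen (.x (g.perm i))) * F (freeEl W g)) := by
  by_cases h : g ∈ W
  · rw [freeEl_of_mem h, hwx]
  · simp [freeEl_of_notMem h]

theorem freeReflEl_mul_x_of_ne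
    (hxc : ∀ i j : Fin n, i ≠ j →
      F (gen (.x i)) * F (gen (.c j)) = F (gen (.c j)) * F (gen (.x i)))
    (hwx : ∀ (g : W) (i : Fin n), F (gen (.w g)) * F (gen (.x i))
      = ((g.1.sign i : ℤ) : ℂ) • (F (gen (.x (g.1.perm i))) * F (gen (.w g))))
    {k i j : Fin n} (hk : j ≠ k) (hi : j ≠ i) (σ : ℤˣ) :
    F (freeReflEl W k i σ) * F (gen (.x j)) = F (gen (.x j)) * F (freeReflEl W k i σ) := by
  rw [freeReflEl, map_mul, mul_assoc, freeEl_mul_x hwx, refl_perm_of_ne hk hi,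
    refl_sign_of_ne hk hi, Units.val_one, Int.cast_one, one_smul, ← mul_assoc, ← mul_assoc]
  congr 1
  simp only [map_add, map_one, map_smul, map_mul, add_mul, mul_add, one_mul, mul_one,
    smul_mul_assoc, mul_smul_comm]
  rw [mul_assoc, ← hxc j i hi, ← mul_assoc, ← hxc j k hk, mul_assoc]

/-- Put `p = c_j c_i`, which anticommutes with both `x_i` and `x_j`. The two reflection elements are
`(1 + σ p) r` and `(1 - σ p) r` with the same `r`. Moving `x_i` and `x_j` to the left flips the sign
of `p`, and both sides become `σ x_i (1 - σ p) r - x_j (1 + σ p) r`. -/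
theorem freeReflEl_mul_x_left
    (hc : ∀ i j : Fin n, i ≠ j →
      F (gen (.c i)) * F (gen (.c j)) = -(F (gen (.c j)) * F (gen (.c i))))
    (hxcs : ∀ i : Fin n, F (gen (.x i)) * F (gen (.c i)) = -(F (gen (.c i)) * F (gen (.x i))))
    (hxc : ∀ i j : Fin n, i ≠ j →
      F (gen (.x i)) * F (gen (.c j)) = F (gen (.c j)) * F (gen (.x i)))
    (hwx : ∀ (g : W) (i : Fin n), F (gen (.w g)) * F (gen (.x i))
      = ((g.1.sign i : ℤ) : ℂ) • (F (gen (.x (g.1.perm i))) * F (gen (.w g))))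
    {i j : Fin n} (h : j ≠ i) (σ : ℤˣ) :
    F (freeReflEl W j i σ) * F (gen (.x j)) - F (gen (.x j)) * F (freeReflEl W j i σ)
      = -(((σ : ℤ) : ℂ) • (F (freeReflEl W i j σ) * F (gen (.x i))
          - F (gen (.x i)) * F (freeReflEl W i j σ))) := by
  have e1 : F (gen (.c j)) * F (gen (.c i)) * F (gen (.x i))
      = -(F (gen (.x i)) * (F (gen (.c j)) * F (gen (.c i)))) := by
    rw [mul_assoc, ← neg_eq_iff_eq_neg.2 (hxcs i), mul_neg, ← mul_assoc, ← hxc i j h.symm,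
      mul_assoc]
  have e2 : F (gen (.c i)) * F (gen (.c j)) * F (gen (.x j))
      = -(F (gen (.x j)) * (F (gen (.c i)) * F (gen (.c j)))) := by
    rw [mul_assoc, ← neg_eq_iff_eq_neg.2 (hxcs j), mul_neg, ← mul_assoc, ← hxc j i h, mul_assoc]
  have e3 : F (gen (.c i)) * F (gen (.c j)) = -(F (gen (.c j)) * F (gen (.c i))) := hc i j h.symm
  rw [e3] at e2
  rw [freeReflEl, freeReflEl, refl_comm i j, map_mul, map_mul, mul_assoc, mul_assoc,
    freeEl_mul_x hwx, freeEl_mul_x hwx, refl_perm_left, refl_perm_right, refl_sign_left h,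
    refl_sign_right h]
  simp only [map_add, map_one, map_smul, map_mul, e3]
  generalize F (freeEl W (refl j i σ)) = E at *
  generalize F (gen (.x i)) = a at *
  generalize F (gen (.x j)) = b at *
  generalize F (gen (.c j)) * F (gen (.c i)) = p at *
  have hs := sign_mul_self σ
  generalize ((σ : ℤ) : ℂ) = t at *
  have e2' : p * b = -(b * p) := by
    rwa [neg_mul, mul_neg, neg_inj] at e2
  have e1' : p * (a * E) = -(a * (p * E)) := by rw [← mul_assoc, e1, neg_mul, mul_assoc]
  have e2'' : p * (b * E) = -(b * (p * E)) := by rw [← mul_assoc, e2', neg_mul, mul_assoc]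
  simp only [add_mul, mul_add, one_mul, smul_mul_assoc, mul_smul_comm, smul_neg, neg_mul,
    mul_neg, smul_add, smul_sub, smul_smul, hs, one_smul, e1', e2'']
  abel

theorem freeEl_tau_mul_x
    (hwx : ∀ (g : W) (i : Fin n), F (gen (.w g)) * F (gen (.x i))
      = ((g.1.sign i : ℤ) : ℂ) • (F (gen (.x (g.1.perm i))) * F (gen (.w g))))
    {i j : Fin n} (h : j ≠ i) :
    F (freeEl W (tau i)) * F (gen (.x j)) = F (gen (.x j)) * F (freeEl W (tau i)) := by
  rw [freeEl_mul_x hwx, tau_perm, tau_sign_of_ne h, Units.val_one, Int.cast_one, one_smul]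

/-- `[κ(i,i), x_j] = [κ(i,j), x_i]` for `i ≠ j`. -/
theorem kappa_self_bracket_x
    (hc : ∀ i j : Fin n, i ≠ j →
      F (gen (.c i)) * F (gen (.c j)) = -(F (gen (.c j)) * F (gen (.c i))))
    (hxcs : ∀ i : Fin n, F (gen (.x i)) * F (gen (.c i)) = -(F (gen (.c i)) * F (gen (.x i))))
    (hxc : ∀ i j : Fin n, i ≠ j →
      F (gen (.x i)) * F (gen (.c j)) = F (gen (.c j)) * F (gen (.x i)))
    (hwx : ∀ (g : W) (i : Fin n), F (gen (.w g)) * F (gen (.x i))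
      = ((g.1.sign i : ℤ) : ℂ) • (F (gen (.x (g.1.perm i))) * F (gen (.w g))))
    (u v : ℂ) {i j : Fin n} (h : j ≠ i) :
    F (kappa W u v i i) * F (gen (.x j)) - F (gen (.x j)) * F (kappa W u v i i)
      = F (kappa W u v i j) * F (gen (.x i)) - F (gen (.x i)) * F (kappa W u v i j) := by
  have e : ∑ k ∈ Finset.univ.erase i, ∑ σ : ℤˣ, (F (freeReflEl W k i σ) * F (gen (.x j))
      - F (gen (.x j)) * F (freeReflEl W k i σ))
      = ∑ σ : ℤˣ, -(((σ : ℤ) : ℂ) • (F (freeReflEl W i j σ) * F (gen (.x i))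
          - F (gen (.x i)) * F (freeReflEl W i j σ))) := by
    -- Reflection elements not involving the index `j` commute with `x_j`, so only `k = j`
    -- contributes.
    rw [Finset.sum_eq_single_of_mem j (by simp [h])]
    · exact Finset.sum_congr rfl fun σ _ => freeReflEl_mul_x_left hc hxcs hxc hwx h σ
    · intro k _ hk
      exact Finset.sum_eq_zero fun σ _ => by
        rw [freeReflEl_mul_x_of_ne hxc hwx hk.symm h, sub_self]
  rw [kappa_self, kappa_of_ne h]
  simp only [map_sub, map_neg, map_smul, map_sum, sub_mul, mul_sub, neg_mul, mul_neg,
    smul_mul_assoc, mul_smul_comm, Finset.sum_mul, Finset.mul_sum, freeEl_tau_mul_x hwx h]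
  simp only [Finset.sum_sub_distrib, Finset.sum_neg_distrib, smul_sub] at e
  have e' := congrArg (fun z => u • z) e
  simp only [smul_sub, smul_neg] at e'
  rw [← neg_inj] at e'
  simp only [neg_sub] at e'
  rw [← e']
  abel

/-- `[κ(k,i), x_j] = [κ(k,j), x_i]`. -/
theorem kappa_bracket_x
    (hc : ∀ i j : Fin n, i ≠ j →
      F (gen (.c i)) * F (gen (.c j)) = -(F (gen (.c j)) * F (gen (.c i))))
    (hxcs : ∀ i : Fin n, F (gen (.x i)) * F (gen (.c i)) = -(F (gen (.c i)) * F (gen (.x i))))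
    (hxc : ∀ i j : Fin n, i ≠ j →
      F (gen (.x i)) * F (gen (.c j)) = F (gen (.c j)) * F (gen (.x i)))
    (hwx : ∀ (g : W) (i : Fin n), F (gen (.w g)) * F (gen (.x i))
      = ((g.1.sign i : ℤ) : ℂ) • (F (gen (.x (g.1.perm i))) * F (gen (.w g))))
    (u v : ℂ) (k i j : Fin n) :
    F (kappa W u v k i) * F (gen (.x j)) - F (gen (.x j)) * F (kappa W u v k i)
      = F (kappa W u v k j) * F (gen (.x i)) - F (gen (.x i)) * F (kappa W u v k j) := by
  by_cases hij : j = i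
  · rw [hij]
  by_cases hki : k = i
  · rw [hki]; exact kappa_self_bracket_x hc hxcs hxc hwx u v hij
  by_cases hkj : k = j
  · rw [hkj]; exact (kappa_self_bracket_x hc hxcs hxc hwx u v (Ne.symm hij)).symm
  -- For three distinct indices both brackets vanish: `[y_k, x_i]` involves only the indices `k` and
  -- `i`.
  have key (i j : Fin n) (hij : j ≠ i) (hki : k ≠ i) (hkj : k ≠ j) :
      F (kappa W u v k i) * F (gen (.x j)) = F (gen (.x j)) * F (kappa W u v k i) := by
    rw [kappa_of_ne (Ne.symm hki)]
    simp only [map_smul, map_sum, smul_mul_assoc, mul_smul_comm, Finset.sum_mul, Finset.mul_sum,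
      freeReflEl_mul_x_of_ne hxc hwx (Ne.symm hkj) hij]
  rw [key i j hij hki hkj, key j i (Ne.symm hij) hkj hki, sub_self, sub_self]

end Jacobi

/-! ### The operators on `ℂ[y_1, …, y_n] ⊗ M` -/

section Operators

open MvPolynomial

variable (M : Type*) [AddCommGroup M] [Module ℂ M] [Module (K W) M] [IsScalarTower ℂ (K W) M]

variable (W) in
/-- The operator by which `x_i` acts: a sum of Dunkl operators without derivative part. -/
def opX (u v : ℂ) (i : Fin n) : Module.End ℂ (MvPolynomial (Fin n) ℂ ⊗[ℂ] M) :=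
  u • ∑ k ∈ Finset.univ.erase i, ∑ σ : ℤˣ,
      TensorProduct.map (reflDiff k i σ) (Algebra.lsmul ℂ ℂ M (K.reflEl W k i σ))
    + v • TensorProduct.map (tauDiff i) (Algebra.lsmul ℂ ℂ M (K.el W (tau i)))

/-- The operators by which the generators act. -/
def opGen (u v : ℂ) : Gen W → Module.End ℂ (MvPolynomial (Fin n) ℂ ⊗[ℂ] M)
  | .x i => opX W M u v i
  | .y i => TensorProduct.map (LinearMap.mulLeft ℂ (X i)) LinearMap.id
  | .c i => TensorProduct.map LinearMap.id (Algebra.lsmul ℂ ℂ M (K.c i : K W))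
  | .w g => TensorProduct.map g.1.actPoly.toLinearMap (Algebra.lsmul ℂ ℂ M (K.w g))

/-- The action of the free algebra on `ℂ[y_1, …, y_n] ⊗ M`. -/
def opFree (u v : ℂ) : Free W →ₐ[ℂ] Module.End ℂ (MvPolynomial (Fin n) ℂ ⊗[ℂ] M) :=
  FreeAlgebra.lift ℂ (opGen M u v)

variable {M} (u v : ℂ)

theorem opFree_x (i : Fin n) (f : MvPolynomial (Fin n) ℂ) (m : M) :
    opFree M u v (gen (.x i) : Free W) (f ⊗ₜ m) =
      u • ∑ k ∈ Finset.univ.erase i, ∑ σ : ℤˣ, reflDiff k i σ f ⊗ₜ[ℂ] (K.reflEl W k i σ • m)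
        + v • tauDiff i f ⊗ₜ[ℂ] (K.el W (tau i) • m) := by
  simp [opFree, opGen, opX, LinearMap.sum_apply]

theorem opFree_y (i : Fin n) (f : MvPolynomial (Fin n) ℂ) (m : M) :
    opFree M u v (gen (.y i) : Free W) (f ⊗ₜ m) = (X i * f) ⊗ₜ m := by
  simp [opFree, opGen]

theorem opFree_c (i : Fin n) (f : MvPolynomial (Fin n) ℂ) (m : M) :
    opFree M u v (gen (.c i) : Free W) (f ⊗ₜ m) = f ⊗ₜ ((K.c i : K W) • m) := by
  simp [opFree, opGen]

theorem opFree_w (g : W) (f : MvPolynomial (Fin n) ℂ) (m : M) :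
    opFree M u v (gen (.w g)) (f ⊗ₜ m) = g.1.actPoly f ⊗ₜ (K.w g • m) := by
  simp [opFree, opGen]

theorem opFree_freeEl (g : SignedPerm n) (f : MvPolynomial (Fin n) ℂ) (m : M) :
    opFree M u v (freeEl W g) (f ⊗ₜ m) = g.actPoly f ⊗ₜ (K.el W g • m) := by
  by_cases h : g ∈ W
  · rw [freeEl_of_mem h, K.el_of_mem h, opFree_w]
  · simp [freeEl_of_notMem h, K.el_of_notMem h]

theorem opFree_freeReflEl (k i : Fin n) (σ : ℤˣ) (f : MvPolynomial (Fin n) ℂ) (m : M) :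
    opFree M u v (freeReflEl W k i σ) (f ⊗ₜ m)
      = (refl k i σ).actPoly f ⊗ₜ (K.reflEl W k i σ • m) := by
  rw [freeReflEl, map_mul, Module.End.mul_apply, opFree_freeEl, map_add, map_one, map_smul,
    map_mul, LinearMap.add_apply, LinearMap.smul_apply, Module.End.mul_apply, opFree_c, opFree_c,
    Module.End.one_apply, ← TensorProduct.tmul_smul, ← TensorProduct.tmul_add, K.reflEl]
  simp only [mul_smul, add_smul, one_smul, smul_assoc]

/-! ### The defining relations hold -/

theorem opFree_ext {a b : Module.End ℂ (MvPolynomial (Fin n) ℂ ⊗[ℂ] M)}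
    (h : ∀ (f : MvPolynomial (Fin n) ℂ) (m : M), a (f ⊗ₜ m) = b (f ⊗ₜ m)) : a = b :=
  TensorProduct.ext' h

/-- By the Leibniz rule the terms `y_j Δ(f)` cancel and `-Δ(y_j) f^r` remains. For `j = i` every
reflection and `τ_i` contribute with coefficient `-1`; for `j ≠ i` only the two reflections with `k
= j` survive, with coefficient `σ`. -/
theorem opFree_y_x (j i : Fin n) :
    opFree (W := W) M u v (gen (.y j) * gen (.x i) - gen (.x i) * gen (.y j) : Free W)
      = opFree (W := W) M u v (kappa W u v j i) := by
  refine opFree_ext fun f m => ?_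
  rw [map_sub, map_mul, map_mul, LinearMap.sub_apply, Module.End.mul_apply, Module.End.mul_apply,
    opFree_y, opFree_x, opFree_x]
  simp only [map_add, map_smul, map_sum, opFree_y]
  by_cases h : i = j
  · subst h
    rw [kappa_self]
    simp only [map_sub, map_neg, map_smul, map_sum, LinearMap.sub_apply, LinearMap.neg_apply,
      LinearMap.smul_apply, LinearMap.sum_apply, opFree_freeReflEl, opFree_freeEl,
      tauDiff_X_self_mul, TensorProduct.add_tmul]
    have e : ∑ k ∈ Finset.univ.erase i, ∑ σ : ℤˣ,
          reflDiff k i σ (X i * f) ⊗ₜ[ℂ] (K.reflEl W k i σ • m)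
        = ∑ k ∈ Finset.univ.erase i, ∑ σ : ℤˣ,
          (X i * reflDiff k i σ f) ⊗ₜ[ℂ] (K.reflEl W k i σ • m)
        + ∑ k ∈ Finset.univ.erase i, ∑ σ : ℤˣ,
          (refl k i σ).actPoly f ⊗ₜ[ℂ] (K.reflEl W k i σ • m) := by
      rw [← Finset.sum_add_distrib]
      refine Finset.sum_congr rfl fun k hk => ?_
      rw [← Finset.sum_add_distrib]
      refine Finset.sum_congr rfl fun σ _ => ?_
      rw [reflDiff_X_self_mul (Finset.ne_of_mem_erase hk), TensorProduct.add_tmul]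
    rw [e, smul_add, smul_add]
    abel
  · rw [kappa_of_ne h]
    simp only [map_smul, map_sum, LinearMap.smul_apply, LinearMap.sum_apply, opFree_freeReflEl,
      tauDiff_X_mul_of_ne (Ne.symm h)]
    have e : ∑ k ∈ Finset.univ.erase i, ∑ σ : ℤˣ,
          (X j * reflDiff k i σ f) ⊗ₜ[ℂ] (K.reflEl W k i σ • m)
        = ∑ k ∈ Finset.univ.erase i, ∑ σ : ℤˣ,
          reflDiff k i σ (X j * f) ⊗ₜ[ℂ] (K.reflEl W k i σ • m)
        + ∑ σ : ℤˣ, ((σ : ℤ) : ℂ) • (refl j i σ).actPoly f ⊗ₜ[ℂ] (K.reflEl W j i σ • m) := by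
      have hj : j ∈ Finset.univ.erase i := by simp [Ne.symm h]
      rw [← Finset.sum_erase_add _ _ hj, ← Finset.sum_erase_add _ _ hj, add_assoc,
        ← Finset.sum_add_distrib]
      congr 1
      · refine Finset.sum_congr rfl fun k hk => Finset.sum_congr rfl fun σ _ => ?_
        rw [reflDiff_X_mul_of_ne (Finset.ne_of_mem_erase (Finset.mem_of_mem_erase hk))
          (Finset.ne_of_mem_erase hk).symm (Ne.symm h)]
      · refine Finset.sum_congr rfl fun σ _ => ?_
        rw [reflDiff_X_left_mul (Ne.symm h), TensorProduct.smul_tmul', ← TensorProduct.add_tmul,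
          sub_add_cancel]
    rw [e, smul_add]
    abel

theorem opFree_x_c_self (i : Fin n) :
    opFree (W := W) M u v (gen (.x i) * gen (.c i) : Free W)
      = opFree (W := W) M u v (-(gen (.c i) * gen (.x i))) := by
  refine opFree_ext fun f m => ?_
  rw [map_neg, map_mul, map_mul, LinearMap.neg_apply, Module.End.mul_apply, Module.End.mul_apply,
    opFree_c, opFree_x, opFree_x]
  simp only [map_add, map_smul, map_sum, opFree_c, smul_smul, K.el_tau_mul_c_self, neg_smul,
    TensorProduct.tmul_neg, smul_neg, neg_add]
  congr 1
  rw [eq_neg_iff_add_eq_zero, ← smul_add, ← Finset.sum_add_distrib, Finset.sum_eq_zero, smul_zero]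
  intro k hk
  rw [← Finset.sum_add_distrib]
  refine Finset.sum_eq_zero fun σ _ => ?_
  rw [K.reflEl_mul_c_self (Finset.ne_of_mem_erase hk), neg_smul, TensorProduct.tmul_neg,
    neg_add_cancel]

theorem opFree_x_c {i j : Fin n} (h : i ≠ j) :
    opFree (W := W) M u v (gen (.x i) * gen (.c j) : Free W)
      = opFree (W := W) M u v (gen (.c j) * gen (.x i)) := by
  refine opFree_ext fun f m => ?_
  rw [map_mul, map_mul, Module.End.mul_apply, Module.End.mul_apply, opFree_c, opFree_x, opFree_x]
  simp only [map_add, map_smul, map_sum, opFree_c, smul_smul, K.el_tau_mul_c (Ne.symm h)]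
  congr 2
  refine Finset.sum_congr rfl fun k hk => Finset.sum_congr rfl fun σ _ => ?_
  rw [K.reflEl_mul_c (Finset.ne_of_mem_erase hk) (Ne.symm h)]

theorem opFree_w_mul_x (g : W) (i : Fin n) :
    opFree (W := W) M u v (gen (.w g)) * opFree (W := W) M u v (gen (.x i)) = ((g.1.sign i : ℤ) : ℂ) •
      (opFree (W := W) M u v (gen (.x (g.1.perm i))) * opFree (W := W) M u v (gen (.w g))) := by
  refine opFree_ext fun f m => ?_
  rw [LinearMap.smul_apply, Module.End.mul_apply, Module.End.mul_apply,
    opFree_w, opFree_x, opFree_x]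
  simp only [map_add, map_smul, map_sum, opFree_w, actPoly_tauDiff, smul_smul, K.w_mul_el_tau,
    smul_add, ← TensorProduct.smul_tmul']
  rw [mul_comm v, ← smul_smul _ u]
  congr 1
  rw [smul_comm _ u]
  congr 1
  rw [Finset.smul_sum]
  -- Conjugation by `g` permutes the summands: `k` becomes `g.1.perm k`, and `σ` is multiplied by
  -- the signs of `g` at `k` and `i`.
  refine Finset.sum_equiv g.1.perm (by simp) fun k hk => ?_
  have hk' : k ≠ i := Finset.ne_of_mem_erase hk
  rw [Finset.smul_sum]
  refine Fintype.sum_equiv (Equiv.mulRight (g.1.sign k * g.1.sign i)) _ _ fun σ => ?_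
  rw [actPoly_reflDiff g.1 hk', K.w_mul_reflEl g hk', Equiv.coe_mulRight,
    TensorProduct.smul_tmul']

theorem opFree_x_one (i : Fin n) (m : M) :
    opFree (W := W) M u v (gen (.x i) : Free W) (1 ⊗ₜ m) = 0 := by
  simp [opFree_x, reflDiff_one, tauDiff_one]

theorem opFree_c_anti {i j : Fin n} (h : i ≠ j) :
    opFree (W := W) M u v (gen (.c i) * gen (.c j) : Free W)
      = opFree (W := W) M u v (-(gen (.c j) * gen (.c i))) := by
  refine opFree_ext fun f m => ?_
  rw [map_neg, map_mul, map_mul, LinearMap.neg_apply, Module.End.mul_apply, Module.End.mul_apply,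
    opFree_c, opFree_c, opFree_c, opFree_c, smul_smul, smul_smul, K.c_mul_anti h, neg_smul,
    TensorProduct.tmul_neg]

/-- An operator that commutes with the `y_i` and kills `1 ⊗ M` is zero. -/
theorem eq_zero_of_commute_y {L : Module.End ℂ (MvPolynomial (Fin n) ℂ ⊗[ℂ] M)}
    (hL : ∀ k, L * opFree (W := W) M u v (gen (.y k) : Free W) = opFree (W := W) M u v (gen (.y k) : Free W) * L)
    (h1 : ∀ m, L (1 ⊗ₜ m) = 0) : L = 0 := by
  refine opFree_ext fun f m => ?_
  rw [LinearMap.zero_apply]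
  induction f using MvPolynomial.induction_on generalizing m with
  | C a =>
    rw [← mul_one (C a), ← smul_eq_C_mul, ← TensorProduct.smul_tmul', map_smul, h1, smul_zero]
  | add f g hf hg => rw [TensorProduct.add_tmul, map_add, hf, hg, add_zero]
  | mul_X f k hf =>
    have := congrArg (fun T => T (f ⊗ₜ[ℂ] m)) (hL k)
    simp only [Module.End.mul_apply, opFree_y, hf, map_zero] at this
    rwa [mul_comm]

/-- The composite operators are never expanded: the commutator commutes with the `y_k` by the Jacobi
identity and kills `1 ⊗ M` because divided differences kill constants. -/
theorem opFree_x_comm (i j : Fin n) :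
    opFree (W := W) M u v (gen (.x i) * gen (.x j) : Free W)
      = opFree (W := W) M u v (gen (.x j) * gen (.x i)) := by
  rw [map_mul, map_mul, ← sub_eq_zero]
  refine eq_zero_of_commute_y (W := W) u v (fun k => ?_) fun m => ?_
  · have hc (i j : Fin n) (h : i ≠ j) := opFree_c_anti (W := W) (M := M) u v h
    have hxcs (i : Fin n) := opFree_x_c_self (W := W) (M := M) u v i
    have hxc (i j : Fin n) (h : i ≠ j) := opFree_x_c (W := W) (M := M) u v h
    have hwx := opFree_w_mul_x (W := W) (M := M) u v
    simp only [map_mul, map_neg] at hc hxcs hxc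
    have hb := kappa_bracket_x (A := Module.End ℂ (MvPolynomial (Fin n) ℂ ⊗[ℂ] M))
      (F := opFree (W := W) M u v) hc hxcs hxc hwx u v k i j
    rw [← opFree_y_x, ← opFree_y_x] at hb
    simp only [map_sub, map_mul] at hb
    exact commutator_commute_of_bracket_eq (A := Module.End ℂ (MvPolynomial (Fin n) ℂ ⊗[ℂ] M)) hb
  · simp [opFree_x_one]

theorem opFree_rel {a b : Free W} (h : Rel (kappa W u v) a b) :
    opFree (W := W) M u v a = opFree (W := W) M u v b := by
  have hwinv (g : W) : opFree (W := W) M u v (gen (.w g)) * opFree (W := W) M u v (gen (.w g⁻¹)) = 1 := by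
    refine opFree_ext fun f m => ?_
    rw [Module.End.mul_apply, opFree_w, opFree_w, smul_smul, ← K.w_mul, ← AlgHom.comp_apply,
      ← actPoly_mul, mul_inv_cancel, K.w_one, one_smul, ← Subgroup.coe_mul, mul_inv_cancel,
      Subgroup.coe_one, actPoly_one]
    rfl
  cases h with
  | c_sq i =>
    refine opFree_ext fun f m => ?_
    rw [map_mul, Module.End.mul_apply, opFree_c, opFree_c, smul_smul, K.c_mul_self, one_smul,
      map_one, Module.End.one_apply]
  | c_anti i j h => exact opFree_c_anti u v h
  | w_one =>
    refine opFree_ext fun f m => ?_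
    rw [opFree_w, K.w_one, one_smul, Subgroup.coe_one, actPoly_one, map_one, Module.End.one_apply]
    rfl
  | w_mul g h =>
    refine opFree_ext fun f m => ?_
    rw [map_mul, Module.End.mul_apply, opFree_w, opFree_w, opFree_w, smul_smul, K.w_mul,
      Subgroup.coe_mul, actPoly_mul]
    rfl
  | x_comm i j => exact opFree_x_comm u v i j
  | y_comm i j =>
    refine opFree_ext fun f m => ?_
    rw [map_mul, map_mul, Module.End.mul_apply, Module.End.mul_apply, opFree_y, opFree_y,
      opFree_y, opFree_y, mul_left_comm]
  | y_c i j =>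
    refine opFree_ext fun f m => ?_
    rw [map_mul, map_mul, Module.End.mul_apply, Module.End.mul_apply, opFree_y, opFree_c,
      opFree_c, opFree_y]
  | x_c_self i => exact opFree_x_c_self u v i
  | x_c i j h => exact opFree_x_c u v h
  | w_x g i =>
    rw [map_mul, map_mul, opFree_w_mul_x, smul_mul_assoc, mul_assoc, hwinv, mul_one, map_smul]
  | w_y g i =>
    have : opFree (W := W) M u v (gen (.w g)) * opFree (W := W) M u v (gen (.y i)) = ((g.1.sign i : ℤ) : ℂ) •
        (opFree (W := W) M u v (gen (.y (g.1.perm i))) * opFree (W := W) M u v (gen (.w g))) := by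
      refine opFree_ext fun f m => ?_
      rw [LinearMap.smul_apply, Module.End.mul_apply, Module.End.mul_apply, opFree_w, opFree_y,
        opFree_w, opFree_y, map_mul, actPoly_X, smul_mul_assoc, TensorProduct.smul_tmul']
    rw [map_mul, map_mul, this, smul_mul_assoc, mul_assoc, hwinv, mul_one, map_smul]
  | w_c g i =>
    have : opFree (W := W) M u v (gen (.w g)) * opFree (W := W) M u v (gen (.c i)) = ((g.1.sign i : ℤ) : ℂ) •
        (opFree (W := W) M u v (gen (.c (g.1.perm i))) * opFree (W := W) M u v (gen (.w g))) := by
      refine opFree_ext fun f m => ?_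
      rw [LinearMap.smul_apply, Module.End.mul_apply, Module.End.mul_apply, opFree_w, opFree_c,
        opFree_w, opFree_c, smul_smul, smul_smul, K.w_mul_c, smul_assoc, TensorProduct.tmul_smul]
    rw [map_mul, map_mul, this, smul_mul_assoc, mul_assoc, hwinv, mul_one, map_smul]
  | y_x j i => exact opFree_y_x u v j i

end Operators

end DaHCa
end

noncomputable section

namespace DaHCa

open SignedPerm MvPolynomial

variable {n : ℕ} {W : Subgroup (SignedPerm n)}

/-! ### The action of the algebra on `ℂ[y_1, …, y_n] ⊗ M` -/

section Action

variable (M : Type*) [AddCommGroup M] [Module ℂ M] [Module (K W) M] [IsScalarTower ℂ (K W) M]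
variable (u v : ℂ)

/-- The action of `𝓗` on `ℂ[y_1, …, y_n] ⊗ M`. -/
def opAlg : Alg (kappa W u v) →ₐ[ℂ] Module.End ℂ (MvPolynomial (Fin n) ℂ ⊗[ℂ] M) :=
  RingCon.liftₐ (ringConGen (Rel (kappa W u v))) (opFree M u v)
    (RingCon.ringConGen_le.2 fun _ _ h => opFree_rel u v h)

variable {M}

/-- Constants are invariant under `W`, so the generators of `K` act on `1 ⊗ M` through `M` alone. -/
theorem opAlg_ofK (a : K W) (m : M) :
    opAlg M u v (ofK (kappa W u v) a) (1 ⊗ₜ m) = 1 ⊗ₜ (a • m) := by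
  have ha : a ∈ Algebra.adjoin ℂ (Set.range (K.c (W := W)) ∪ Set.range (K.w (W := W))) := by
    rw [K.adjoin_eq_top]; trivial
  induction ha using Algebra.adjoin_induction generalizing m with
  | mem a ha =>
    rcases ha with ⟨i, rfl⟩ | ⟨g, rfl⟩
    · rw [ofK_c]; exact opFree_c u v i 1 m
    · rw [ofK_w]
      refine (opFree_w u v g 1 m).trans ?_
      rw [map_one]
  | algebraMap r =>
    rw [AlgHom.commutes, AlgHom.commutes, Module.algebraMap_end_apply, algebraMap_smul,
      TensorProduct.tmul_smul]
  | add a b _ _ ha hb =>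
    rw [map_add, map_add, LinearMap.add_apply, ha, hb, add_smul, TensorProduct.tmul_add]
  | mul a b _ _ ha hb =>
    rw [map_mul, map_mul, Module.End.mul_apply, hb, ha, mul_smul]

theorem opAlg_x_one (i : Fin n) (m : M) : opAlg M u v (x (kappa W u v) i) (1 ⊗ₜ m) = 0 :=
  opFree_x_one u v i m

theorem opAlg_polyY (f g : MvPolynomial (Fin n) ℂ) (m : M) :
    opAlg M u v (polyY (kappa W u v) f) (g ⊗ₜ m) = (f * g) ⊗ₜ m := by
  induction f using MvPolynomial.induction_on generalizing g with
  | C a =>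
    rw [← algebraMap_eq, AlgHom.commutes, AlgHom.commutes, Module.algebraMap_end_apply,
      TensorProduct.smul_tmul', Algebra.smul_def]
  | add f f' hf hf' => rw [map_add, map_add, LinearMap.add_apply, hf, hf', add_mul,
      TensorProduct.add_tmul]
  | mul_X f k hf =>
    have hX : opAlg M u v (y (kappa W u v) k) (g ⊗ₜ m) = (X k * g) ⊗ₜ m := opFree_y u v k g m
    rw [map_mul, map_mul, Module.End.mul_apply, polyY_X, hX, hf, mul_assoc]

end Action

/-! ### The trivial extension -/

section TrivialExtension

variable {M : Type*} [AddCommGroup M] [Module ℂ M] [Module (K W) M] [IsScalarTower ℂ (K W) M]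
variable {u v : ℂ}

variable (n M) in
/-- Evaluation of polynomials at `0`, as a map `ℂ[y_1, …, y_n] ⊗ M → M`. -/
def evalZero : MvPolynomial (Fin n) ℂ ⊗[ℂ] M →ₗ[ℂ] M :=
  (TensorProduct.lid ℂ M).toLinearMap.comp
    ((aeval (0 : Fin n → ℂ)).toLinearMap.rTensor M)

theorem evalZero_one_tmul (m : M) : evalZero n M (1 ⊗ₜ m) = m := by simp [evalZero]

/-- Stability of `1 ⊗ M` under `𝓗_x`, expressed through the projection `evalZero`. It makes the
compression of the action to `M` multiplicative. -/
theorem one_tmul_evalZero_opAlg {b : Alg (kappa W u v)} (hb : b ∈ Hx (kappa W u v)) (m : M) :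
    (1 : MvPolynomial (Fin n) ℂ) ⊗ₜ[ℂ] evalZero n M (opAlg M u v b (1 ⊗ₜ m))
      = opAlg M u v b (1 ⊗ₜ m) := by
  induction hb using Algebra.adjoin_induction generalizing m with
  | mem b hb =>
    rcases hb with ⟨a, rfl⟩ | ⟨i, rfl⟩
    · rw [opAlg_ofK, evalZero_one_tmul]
    · rw [opAlg_x_one, map_zero, TensorProduct.tmul_zero]
  | algebraMap r =>
    rw [AlgHom.commutes, Module.algebraMap_end_apply, map_smul, evalZero_one_tmul,
      TensorProduct.tmul_smul]
  | add a b _ _ ha hb =>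
    rw [map_add, LinearMap.add_apply, map_add, TensorProduct.tmul_add, ha, hb]
  | mul a b _ _ ha hb =>
    rw [map_mul, Module.End.mul_apply, ← hb, ha]

variable (W M u v) in
/-- The extension of the `K`-module `M` to an `𝓗_x`-module on which the `x_i` act by `0`, realised
on the subspace `1 ⊗ M` of `ℂ[y_1, …, y_n] ⊗ M`. -/
def trivialExtension : Hx (kappa W u v) →ₐ[ℂ] Module.End ℂ M :=
  AlgHom.ofLinearMap
    { toFun := fun b => (evalZero n M).comp
        ((opAlg M u v b.1).comp (TensorProduct.mk ℂ (MvPolynomial (Fin n) ℂ) M 1))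
      map_add' := fun a b => by ext m; simp
      map_smul' := fun r a => by ext m; simp }
    (by ext m; simp [evalZero_one_tmul])
    (fun a b => by
      ext m
      simp only [LinearMap.coe_mk, AddHom.coe_mk, LinearMap.comp_apply, TensorProduct.mk_apply,
        Module.End.mul_apply, one_tmul_evalZero_opAlg b.2]
      simp)

theorem trivialExtension_apply (b : Hx (kappa W u v)) (m : M) :
    trivialExtension W M u v b m = evalZero n M (opAlg M u v b.1 (1 ⊗ₜ m)) := rfl

theorem isTrivialExtension_trivialExtension :
    IsTrivialExtension (trivialExtension W M u v) := by
  refine ⟨fun a m => ?_, fun i m => ?_⟩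
  · rw [trivialExtension_apply, opAlg_ofK, evalZero_one_tmul]
  · rw [trivialExtension_apply, opAlg_x_one, map_zero]

variable {ρ : Hx (kappa W u v) →ₐ[ℂ] Module.End ℂ M}

/-- The two actions agree on the generators of `𝓗_x`. This yields uniqueness of `ρ`, and later shows
that `a ⊗ m ↦ a (1 ⊗ m)` respects the tensor product over `𝓗_x`. -/
theorem IsTrivialExtension.one_tmul (hρ : IsTrivialExtension ρ) (b : Hx (kappa W u v)) (m : M) :
    (1 : MvPolynomial (Fin n) ℂ) ⊗ₜ[ℂ] ρ b m = opAlg M u v b.1 (1 ⊗ₜ m) := by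
  obtain ⟨b, hb⟩ := b
  induction hb using Algebra.adjoin_induction generalizing m with
  | mem b hb =>
    rcases hb with ⟨a, rfl⟩ | ⟨i, rfl⟩
    · rw [opAlg_ofK]; exact congrArg _ (hρ.1 a m)
    · rw [opAlg_x_one]
      exact (congrArg _ (hρ.2 i m)).trans (TensorProduct.tmul_zero _ _)
  | algebraMap r =>
    have : ρ ⟨algebraMap ℂ _ r, Subalgebra.algebraMap_mem _ r⟩ = algebraMap ℂ _ r := ρ.commutes r
    rw [this, AlgHom.commutes, Module.algebraMap_end_apply, Module.algebraMap_end_apply,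
      TensorProduct.tmul_smul]
  | add a b ha' hb' ha hb =>
    have : ρ ⟨a + b, Subalgebra.add_mem _ ha' hb'⟩ = ρ ⟨a, ha'⟩ + ρ ⟨b, hb'⟩ :=
      map_add ρ ⟨a, ha'⟩ ⟨b, hb'⟩
    rw [this, LinearMap.add_apply, TensorProduct.tmul_add, ha, hb, map_add, LinearMap.add_apply]
  | mul a b ha' hb' ha hb =>
    have : ρ ⟨a * b, Subalgebra.mul_mem _ ha' hb'⟩ = ρ ⟨a, ha'⟩ * ρ ⟨b, hb'⟩ :=
      map_mul ρ ⟨a, ha'⟩ ⟨b, hb'⟩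
    rw [this, Module.End.mul_apply, ha, hb, map_mul, Module.End.mul_apply]

theorem IsTrivialExtension.eq_trivialExtension (hρ : IsTrivialExtension ρ) :
    ρ = trivialExtension W M u v := by
  refine AlgHom.ext fun b => LinearMap.ext fun m => ?_
  rw [trivialExtension_apply, ← hρ.one_tmul, evalZero_one_tmul]

end TrivialExtension

/-! ### The induced module -/

theorem Ind.mk_mul_tmul {A : Type*} [Ring A] [Algebra ℂ A] {S : Subalgebra ℂ A} {M : Type*}
    [AddCommGroup M] [Module ℂ M] (ρ : S →ₐ[ℂ] Module.End ℂ M) (a : A) (b : S) (m : M) :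
    (Submodule.Quotient.mk ((a * (b : A)) ⊗ₜ[ℂ] m) : Ind ρ)
      = Submodule.Quotient.mk (a ⊗ₜ[ℂ] ρ b m) :=
  (Submodule.Quotient.eq _).2 (Submodule.subset_span ⟨a, b, m, rfl⟩)

section Induced

variable {κ : Fin n → Fin n → Free W}

theorem smul_ident_tmul {M : Type*} [AddCommGroup M] [Module ℂ M]
    (ρ : Hx κ →ₐ[ℂ] Module.End ℂ M) (a : Alg κ) (f : MvPolynomial (Fin n) ℂ) (m : M) :
    a • ident ρ (f ⊗ₜ m) = Submodule.Quotient.mk ((a * polyY κ f) ⊗ₜ[ℂ] m) := rfl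

theorem polyY_mul_c (f : MvPolynomial (Fin n) ℂ) (i : Fin n) :
    polyY κ f * c κ i = c κ i * polyY κ f := by
  induction f using MvPolynomial.induction_on with
  | C a => rw [← algebraMap_eq, AlgHom.commutes, Algebra.commutes]
  | add f g hf hg => rw [map_add, add_mul, mul_add, hf, hg]
  | mul_X f k hf =>
    have hk : y κ k * c κ i = c κ i * y κ k := by
      simpa [y, c] using toAlg_rel κ (Rel.y_c k i)
    rw [map_mul, polyY_X, mul_assoc, hk, ← mul_assoc, hf, mul_assoc]

theorem w_mul_polyY (g : W) (f : MvPolynomial (Fin n) ℂ) :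
    w κ g * polyY κ f = polyY κ (g.1.actPoly f) * w κ g := by
  induction f using MvPolynomial.induction_on with
  | C a => rw [← algebraMap_eq, AlgHom.commutes, AlgHom.commutes, AlgHom.commutes,
      Algebra.commutes]
  | add f g hf hg => rw [map_add, map_add, map_add, add_mul, mul_add, hf, hg]
  | mul_X f k hf =>
    have hk : w κ g * y κ k = (((g.1.sign k : ℤ) : ℂ) • y κ (g.1.perm k)) * w κ g := by
      have h : w κ g * y κ k * w κ g⁻¹ = ((g.1.sign k : ℤ) : ℂ) • y κ (g.1.perm k) := by
        simpa [w, y] using toAlg_rel κ (Rel.w_y g k)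
      have h1 : w κ g⁻¹ * w κ g = 1 := by
        change wHom κ g⁻¹ * wHom κ g = 1
        rw [← map_mul, inv_mul_cancel, map_one]
      rw [← h, mul_assoc, h1, mul_one]
    rw [map_mul, map_mul, map_mul, polyY_X, actPoly_X, map_smul, polyY_X, ← mul_assoc, hf,
      mul_assoc, hk, ← mul_assoc]

theorem IsTrivialExtension.mk_mul_ofK {M : Type*} [AddCommGroup M] [Module ℂ M] [Module (K W) M]
    {ρ : Hx κ →ₐ[ℂ] Module.End ℂ M} (hρ : IsTrivialExtension ρ) (f : MvPolynomial (Fin n) ℂ)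
    (a : K W) (m : M) :
    (Submodule.Quotient.mk ((polyY κ f * ofK κ a) ⊗ₜ[ℂ] m) : Ind ρ) = ident ρ (f ⊗ₜ (a • m)) := by
  rw [ident_tmul, ← hρ.1 a m]
  exact Ind.mk_mul_tmul ρ _ ⟨_, ofK_mem_Hx κ a⟩ m

end Induced

/-! ### Comparison of the operators with the action on the induced module -/

section Intertwining

variable {M : Type*} [AddCommGroup M] [Module ℂ M] [Module (K W) M] [IsScalarTower ℂ (K W) M]
variable {u v : ℂ} {ρ : Hx (kappa W u v) →ₐ[ℂ] Module.End ℂ M}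

variable (ρ) in
/-- The elements of the free algebra whose action is intertwined by `ident`. -/
def intertwined : Subalgebra ℂ (Free W) where
  carrier := {a | ∀ z, toAlg (kappa W u v) a • ident ρ z = ident ρ (opFree M u v a z)}
  mul_mem' {a b} ha hb z := by
    rw [map_mul, map_mul, mul_smul, hb, ha, Module.End.mul_apply]
  add_mem' {a b} ha hb z := by
    rw [map_add, map_add, add_smul, hb, ha, LinearMap.add_apply, map_add]
  algebraMap_mem' r z := by
    rw [AlgHom.commutes, AlgHom.commutes, Module.algebraMap_end_apply, map_smul, algebraMap_smul]

theorem mem_intertwined_of_tmul {a : Free W}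
    (h : ∀ (f : MvPolynomial (Fin n) ℂ) (m : M), toAlg (kappa W u v) a • ident ρ (f ⊗ₜ m)
      = ident ρ (opFree M u v a (f ⊗ₜ m))) :
    a ∈ intertwined ρ := by
  intro z
  induction z with
  | zero => simp
  | tmul f m => exact h f m
  | add z z' hz hz' => rw [map_add, smul_add, hz, hz', map_add, map_add]

theorem y_mem_intertwined (i : Fin n) : gen (.y i) ∈ intertwined ρ := by
  refine mem_intertwined_of_tmul fun f m => ?_
  rw [opFree_y, smul_ident_tmul, ident_tmul, map_mul, polyY_X]
  rfl

theorem IsTrivialExtension.c_mem_intertwined (hρ : IsTrivialExtension ρ) (i : Fin n) :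
    gen (.c i) ∈ intertwined ρ := by
  refine mem_intertwined_of_tmul fun f m => ?_
  rw [opFree_c, smul_ident_tmul, ← hρ.mk_mul_ofK, ofK_c, polyY_mul_c]
  rfl

theorem IsTrivialExtension.w_mem_intertwined (hρ : IsTrivialExtension ρ) (g : W) :
    gen (.w g) ∈ intertwined ρ := by
  refine mem_intertwined_of_tmul fun f m => ?_
  rw [opFree_w, smul_ident_tmul, ← hρ.mk_mul_ofK, ofK_w, ← w_mul_polyY]
  rfl

theorem IsTrivialExtension.freeEl_mem_intertwined (hρ : IsTrivialExtension ρ)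
    (g : SignedPerm n) : freeEl W g ∈ intertwined ρ := by
  by_cases h : g ∈ W
  · rw [freeEl_of_mem h]; exact hρ.w_mem_intertwined _
  · rw [freeEl_of_notMem h]; exact Subalgebra.zero_mem _

theorem IsTrivialExtension.freeReflEl_mem_intertwined (hρ : IsTrivialExtension ρ)
    (k i : Fin n) (σ : ℤˣ) : freeReflEl W k i σ ∈ intertwined ρ :=
  Subalgebra.mul_mem _ (Subalgebra.add_mem _ (Subalgebra.one_mem _) (Subalgebra.smul_mem _
    (Subalgebra.mul_mem _ (hρ.c_mem_intertwined k) (hρ.c_mem_intertwined i)) _))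
    (hρ.freeEl_mem_intertwined _)

theorem IsTrivialExtension.kappa_mem_intertwined (hρ : IsTrivialExtension ρ) (j i : Fin n) :
    kappa W u v j i ∈ intertwined ρ := by
  by_cases h : i = j
  · subst h
    rw [kappa_self]
    exact Subalgebra.sub_mem _ (Subalgebra.neg_mem _ (Subalgebra.smul_mem _
      (Subalgebra.sum_mem _ fun k _ => Subalgebra.sum_mem _ fun σ _ =>
        hρ.freeReflEl_mem_intertwined k i σ) _))
      (Subalgebra.smul_mem _ (hρ.freeEl_mem_intertwined _) _)
  · rw [kappa_of_ne h]
    exact Subalgebra.smul_mem _ (Subalgebra.sum_mem _ fun σ _ => Subalgebra.smul_mem _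
      (hρ.freeReflEl_mem_intertwined j i σ) _) _

/-- Induction on the degree of `f`: both actions of `x_i` vanish on `1 ⊗ m`, and both satisfy `x_i
y_k = y_k x_i - κ(k, i)`, where `y_k` and `κ(k, i)` are already intertwined. -/
theorem IsTrivialExtension.x_mem_intertwined (hρ : IsTrivialExtension ρ) (i : Fin n) :
    gen (.x i) ∈ intertwined ρ := by
  refine mem_intertwined_of_tmul fun f m => ?_
  induction f using MvPolynomial.induction_on generalizing m with
  | C a =>
    rw [← mul_one (C a), ← smul_eq_C_mul, ← TensorProduct.smul_tmul', map_smul, map_smul,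
      map_smul, opFree_x_one, map_zero, smul_zero, smul_comm, smul_ident_tmul, map_one, mul_one,
      ← one_mul (toAlg _ _)]
    -- In the induced module `x_i ⊗ m = 1 ⊗ ρ(x_i) m = 0`.
    have := Ind.mk_mul_tmul ρ 1 ⟨_, x_mem_Hx (kappa W u v) i⟩ m
    rw [hρ.2] at this
    refine (congrArg (a • ·) this).trans ?_
    simp
  | add f g hf hg => simp only [TensorProduct.add_tmul, map_add, smul_add, hf, hg]
  | mul_X f k hf =>
    have hy := y_mem_intertwined (ρ := ρ) k
    have e : toAlg (kappa W u v) (gen (.y k) * gen (.x i)) - toAlg _ (gen (.x i) * gen (.y k))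
        = toAlg _ (kappa W u v k i) := by
      rw [← map_sub]; exact toAlg_rel _ (Rel.y_x k i)
    rw [map_mul, map_mul, sub_eq_iff_eq_add, ← sub_eq_iff_eq_add'] at e
    have e' := opFree_y_x (W := W) (M := M) u v k i
    rw [map_sub, map_mul, map_mul, sub_eq_iff_eq_add, ← sub_eq_iff_eq_add'] at e'
    have h1 : ((f * X k) ⊗ₜ[ℂ] m : MvPolynomial (Fin n) ℂ ⊗[ℂ] M)
        = opFree M u v (gen (.y k) : Free W) (f ⊗ₜ m) := by rw [opFree_y, mul_comm]
    rw [h1, ← hy, ← mul_smul, ← e, ← Module.End.mul_apply, ← e', sub_smul, mul_smul, hf, hy,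
      hρ.kappa_mem_intertwined, LinearMap.sub_apply, map_sub, Module.End.mul_apply]

theorem IsTrivialExtension.smul_ident (hρ : IsTrivialExtension ρ) (a : Free W)
    (z : MvPolynomial (Fin n) ℂ ⊗[ℂ] M) :
    toAlg (kappa W u v) a • ident ρ z = ident ρ (opFree M u v a z) := by
  suffices h : a ∈ intertwined ρ from h z
  induction a using FreeAlgebra.induction with
  | grade0 r => exact Subalgebra.algebraMap_mem _ r
  | grade1 g =>
    cases g with
    | x i => exact hρ.x_mem_intertwined i
    | y i => exact y_mem_intertwined i
    | c i => exact hρ.c_mem_intertwined i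
    | w g => exact hρ.w_mem_intertwined g
  | mul a b ha hb => exact Subalgebra.mul_mem _ ha hb
  | add a b ha hb => exact Subalgebra.add_mem _ ha hb

theorem IsTrivialExtension.ident_surjective (hρ : IsTrivialExtension ρ) :
    Function.Surjective (ident ρ) := by
  intro z
  obtain ⟨z, rfl⟩ := Submodule.Quotient.mk_surjective _ z
  rw [← LinearMap.mem_range]
  induction z with
  | zero => exact Submodule.zero_mem _
  | tmul a m =>
    obtain ⟨a, rfl⟩ := RingCon.mkₐ_surjective (α := ℂ) (ringConGen (Rel (kappa W u v))) a
    -- The class of `a ⊗ m` is `a` applied to `ident (1 ⊗ m)`, so intertwining supplies the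
    -- preimage.
    refine ⟨opFree M u v a (1 ⊗ₜ m), ?_⟩
    rw [← hρ.smul_ident, smul_ident_tmul, map_one, mul_one]
    rfl
  | add z z' hz hz' => exact Submodule.add_mem _ hz hz'

theorem IsTrivialExtension.ident_injective (hρ : IsTrivialExtension ρ) :
    Function.Injective (ident ρ) := by
  -- The map `a ⊗ m ↦ a (1 ⊗ m)`. It kills the submodule divided out in `Ind ρ`, and it inverts `f ⊗
  -- m ↦ f(y) ⊗ m` from the left because `f(y)` acts by multiplication by `f`.
  let θ : Alg (kappa W u v) ⊗[ℂ] M →ₗ[ℂ] MvPolynomial (Fin n) ℂ ⊗[ℂ] M :=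
    TensorProduct.lift (((TensorProduct.mk ℂ (MvPolynomial (Fin n) ℂ) M 1).lcomp ℂ _).comp
      (opAlg M u v).toLinearMap)
  have hθ (a : Alg (kappa W u v)) (m : M) : θ (a ⊗ₜ m) = opAlg M u v a (1 ⊗ₜ m) := rfl
  have hθs (a : Alg (kappa W u v)) (z) : θ (a • z) = opAlg M u v a (θ z) := by
    induction z with
    | zero => simp
    | tmul b m =>
      rw [TensorProduct.smul_tmul', smul_eq_mul, hθ, hθ, map_mul, Module.End.mul_apply]
    | add z z' hz hz' => rw [smul_add, map_add, map_add, map_add, hz, hz']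
  have hθi (z) : θ ((polyY (kappa W u v)).toLinearMap.rTensor M z) = z := by
    induction z with
    | zero => simp
    | tmul f m =>
      rw [LinearMap.rTensor_tmul, AlgHom.toLinearMap_apply, hθ, opAlg_polyY, mul_one]
    | add z z' hz hz' => rw [map_add, map_add, hz, hz']
  rw [injective_iff_map_eq_zero]
  intro z hz
  rw [← hθi z]
  have hθker : ∀ z' ∈ Submodule.span (Alg (kappa W u v)) {z' : Alg (kappa W u v) ⊗[ℂ] M |
      ∃ (a : Alg (kappa W u v)) (b : Hx (kappa W u v)) (m : M),
        z' = (a * (b : Alg (kappa W u v))) ⊗ₜ[ℂ] m - a ⊗ₜ[ℂ] ρ b m}, θ z' = 0 := by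
    intro z' hz'
    induction hz' using Submodule.span_induction with
    | mem z hz =>
      obtain ⟨a, b, m, rfl⟩ := hz
      rw [map_sub, hθ, hθ, map_mul, Module.End.mul_apply, ← hρ.one_tmul, sub_self]
    | zero => exact map_zero _
    | add z z' _ _ hz hz' => rw [map_add, hz, hz', add_zero]
    | smul a z _ hz => rw [hθs, hz, map_zero]
  exact hθker _ ((Submodule.Quotient.mk_eq_zero _).1 hz)

theorem IsTrivialExtension.x_smul_ident (hρ : IsTrivialExtension ρ) (i : Fin n)
    (f : MvPolynomial (Fin n) ℂ) (m : M) :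
    x (kappa W u v) i • ident ρ (f ⊗ₜ m) = ident ρ
      (u • ∑ k ∈ Finset.univ.erase i, ∑ σ : ℤˣ, reflDiff k i σ f ⊗ₜ[ℂ] (K.reflEl W k i σ • m)
        + v • tauDiff i f ⊗ₜ[ℂ] (K.el W (tau i) • m)) := by
  rw [← opFree_x]
  exact hρ.smul_ident _ _

variable (W M u v) in
/-- The trivial extension, the induced module and the action of the `x_i`, for an arbitrary group
`W` of signed permutations. -/
theorem induced_module :
    (∃! ρ : Hx (kappa W u v) →ₐ[ℂ] Module.End ℂ M, IsTrivialExtension ρ) ∧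
      ∀ ρ : Hx (kappa W u v) →ₐ[ℂ] Module.End ℂ M, IsTrivialExtension ρ →
        Function.Bijective (ident ρ) ∧
        ∀ (i : Fin n) (f : MvPolynomial (Fin n) ℂ) (m : M),
          x (kappa W u v) i • ident ρ (f ⊗ₜ[ℂ] m) = ident ρ
            (u • ∑ k ∈ Finset.univ.erase i, ∑ σ : ℤˣ,
                reflDiff k i σ f ⊗ₜ[ℂ] (K.reflEl W k i σ • m)
              + v • tauDiff i f ⊗ₜ[ℂ] (K.el W (tau i) • m)) :=
  ⟨⟨trivialExtension W M u v, isTrivialExtension_trivialExtension,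
      fun _ hρ => hρ.eq_trivialExtension⟩,
    fun _ hρ => ⟨⟨hρ.ident_injective, hρ.ident_surjective⟩, hρ.x_smul_ident⟩⟩

end Intertwining

end DaHCa
end

noncomputable section

namespace DaHCa

open SignedPerm MvPolynomial

variable {n : ℕ}

/-! ### The types `A`, `B` and `D` -/

theorem sum_sign {A : Type*} [AddCommMonoid A] (f : ℤˣ → A) : ∑ σ, f σ = f 1 + f (-1) := by
  rw [UnitsInt.univ, Finset.sum_insert (by decide), Finset.sum_singleton]

theorem mem_WB (g : SignedPerm n) : g ∈ WB n := Subgroup.mem_top g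

theorem sbar_notMem_WA {k i : Fin n} (h : k ≠ i) : sbar k i ∉ WA n := fun hm => by
  have := hm k
  simp [sbar, h] at this

section Free

variable {W : Subgroup (SignedPerm n)}

theorem freeReflEl_one {k i : Fin n} (h : s k i ∈ W) :
    freeReflEl W k i 1 = (1 + gen (.c k) * gen (.c i)) * gen (.w ⟨s k i, h⟩) := by
  rw [freeReflEl, refl_one, freeEl_of_mem h]
  simp

theorem freeReflEl_neg_one {k i : Fin n} (h : sbar k i ∈ W) :
    freeReflEl W k i (-1) = (1 - gen (.c k) * gen (.c i)) * gen (.w ⟨sbar k i, h⟩) := by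
  rw [freeReflEl, refl_neg_one, freeEl_of_mem h]
  simp [sub_eq_add_neg]

theorem freeReflEl_neg_one_of_notMem {k i : Fin n} (h : sbar k i ∉ W) :
    freeReflEl W k i (-1) = 0 := by
  rw [freeReflEl, refl_neg_one, freeEl_of_notMem h, mul_zero]

theorem K.reflEl_one {k i : Fin n} (h : s k i ∈ W) :
    K.reflEl W k i 1 = (1 + K.c k * K.c i) * K.w ⟨s k i, h⟩ := by
  rw [K.reflEl, refl_one, K.el_of_mem h]
  simp

theorem K.reflEl_neg_one {k i : Fin n} (h : sbar k i ∈ W) :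
    K.reflEl W k i (-1) = (1 - K.c k * K.c i) * K.w ⟨sbar k i, h⟩ := by
  rw [K.reflEl, refl_neg_one, K.el_of_mem h]
  simp [sub_eq_add_neg]

theorem K.reflEl_neg_one_of_notMem {k i : Fin n} (h : sbar k i ∉ W) :
    K.reflEl W k i (-1) = 0 := by
  rw [K.reflEl, refl_neg_one, K.el_of_notMem h, mul_zero]

end Free

theorem s_comm (i j : Fin n) : s i j = s j i := by rw [← refl_one, ← refl_one, refl_comm]

theorem sbar_comm (i j : Fin n) : sbar i j = sbar j i := by
  rw [← refl_neg_one, ← refl_neg_one, refl_comm]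

theorem sB_comm (i j : Fin n) : sB i j = sB j i := Subtype.ext (s_comm i j)

theorem sbarB_comm (i j : Fin n) : sbarB i j = sbarB j i := Subtype.ext (sbar_comm i j)

theorem sD_comm (i j : Fin n) : sD i j = sD j i := Subtype.ext (s_comm i j)

theorem sbarD_comm (i j : Fin n) : sbarD i j = sbarD j i := Subtype.ext (sbar_comm i j)

/-- The terms with `σ = -1` disappear because `s̄` is not in `WA n`. -/
theorem kappaA_eq (u : ℂ) : kappaA (n := n) u = kappa (WA n) u 0 := by
  funext j i
  by_cases h : i = j
  · subst h
    rw [kappa_self, kappaA, if_neg (by simp), zero_smul, sub_zero]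
    congr 2
    refine Finset.sum_congr rfl fun k hk => ?_
    rw [sum_sign, freeReflEl_neg_one_of_notMem (sbar_notMem_WA (Finset.ne_of_mem_erase hk)),
      add_zero, freeReflEl_one (s_mem_WA k i)]
    rfl
  · rw [kappa_of_ne h, kappaA, if_pos h, sum_sign,
      freeReflEl_neg_one_of_notMem (sbar_notMem_WA (Ne.symm h)), smul_zero, add_zero,
      freeReflEl_one (s_mem_WA j i), Units.val_one, Int.cast_one, one_smul]
    rfl

theorem kappaD_eq (u : ℂ) : kappaD (n := n) u = kappa (WD n) u 0 := by
  funext j i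
  by_cases h : i = j
  · subst h
    rw [kappa_self, kappaD, if_neg (by simp), zero_smul, sub_zero]
    congr 2
    refine Finset.sum_congr rfl fun k _ => ?_
    rw [sum_sign, freeReflEl_neg_one (sbar_mem_WD k i), freeReflEl_one (s_mem_WD k i)]
    rfl
  · rw [kappa_of_ne h, kappaD, if_pos h, sum_sign, freeReflEl_neg_one (sbar_mem_WD j i),
      freeReflEl_one (s_mem_WD j i), sD_comm, sbarD_comm, Units.val_neg, Units.val_one,
      Int.cast_neg, Int.cast_one, one_smul, neg_one_smul, ← sub_eq_add_neg]
    rfl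

theorem kappaB_eq (u v : ℂ) :
    kappaB (n := n) u v = kappa (WB n) u (((Real.sqrt 2 : ℝ) : ℂ) * v) := by
  funext j i
  by_cases h : i = j
  · subst h
    rw [kappa_self, kappaB, if_neg (by simp), freeEl_of_mem (mem_WB (tau i))]
    congr 3
    refine Finset.sum_congr rfl fun k _ => ?_
    rw [sum_sign, freeReflEl_neg_one (mem_WB _), freeReflEl_one (mem_WB _)]
    rfl
  · rw [kappa_of_ne h, kappaB, if_pos h, sum_sign, freeReflEl_neg_one (mem_WB _),
      freeReflEl_one (mem_WB _), sB_comm, sbarB_comm, Units.val_neg, Units.val_one,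
      Int.cast_neg, Int.cast_one, one_smul, neg_one_smul, ← sub_eq_add_neg]
    rfl

theorem reflDiff_one_apply {k i : Fin n} (h : k ≠ i) (f : MvPolynomial (Fin n) ℂ) :
    reflDiff k i 1 f = exactDiv (f - (s k i).actPoly f) (X i - X k) := by
  rw [reflDiff_apply h, refl_one, reflForm_one]

theorem reflDiff_neg_one_apply {k i : Fin n} (h : k ≠ i) (f : MvPolynomial (Fin n) ℂ) :
    reflDiff k i (-1) f = exactDiv (f - (sbar k i).actPoly f) (X i + X k) := by
  rw [reflDiff_apply h, refl_neg_one, reflForm_neg_one]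

end DaHCa
end

open DaHCa DaHCa.SignedPerm MvPolynomial Finset in
theorem theorem4 (n : ℕ) (u v : ℂ) :
    -- type B
    (∀ (M : Type*) [AddCommGroup M] [Module ℂ M] [Module (K (WB n)) M]
        [IsScalarTower ℂ (K (WB n)) M],
      (∃! ρ : Hx (kappaB (n := n) u v) →ₐ[ℂ] Module.End ℂ M, IsTrivialExtension ρ) ∧
      ∀ ρ : Hx (kappaB (n := n) u v) →ₐ[ℂ] Module.End ℂ M, IsTrivialExtension ρ →
        Function.Bijective (ident ρ) ∧
        ∀ (i : Fin n) (f : MvPolynomial (Fin n) ℂ) (m : M),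
          x (kappaB u v) i • ident ρ (f ⊗ₜ[ℂ] m) =
            ident ρ
              (u • ∑ k ∈ univ.erase i,
                  exactDiv (f - (s k i).actPoly f) (X i - X k) ⊗ₜ[ℂ]
                    (((1 + K.c k * K.c i) * K.w (sB k i) : K (WB n)) • m)
                + u • ∑ k ∈ univ.erase i,
                  exactDiv (f - (sbar k i).actPoly f) (X i + X k) ⊗ₜ[ℂ]
                    (((1 - K.c k * K.c i) * K.w (sbarB k i) : K (WB n)) • m)
                + (((Real.sqrt 2 : ℝ) : ℂ) * v) •
                  exactDiv (f - (tau i).actPoly f) (2 * X i) ⊗ₜ[ℂ]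
                    ((K.w (tauB i) : K (WB n)) • m))) ∧
    -- type A
    (∀ (M : Type*) [AddCommGroup M] [Module ℂ M] [Module (K (WA n)) M]
        [IsScalarTower ℂ (K (WA n)) M],
      (∃! ρ : Hx (kappaA (n := n) u) →ₐ[ℂ] Module.End ℂ M, IsTrivialExtension ρ) ∧
      ∀ ρ : Hx (kappaA (n := n) u) →ₐ[ℂ] Module.End ℂ M, IsTrivialExtension ρ →
        Function.Bijective (ident ρ) ∧
        ∀ (i : Fin n) (f : MvPolynomial (Fin n) ℂ) (m : M),
          x (kappaA u) i • ident ρ (f ⊗ₜ[ℂ] m) =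
            ident ρ
              (u • ∑ k ∈ univ.erase i,
                exactDiv (f - (s k i).actPoly f) (X i - X k) ⊗ₜ[ℂ]
                  (((1 + K.c k * K.c i) * K.w (sA k i) : K (WA n)) • m))) ∧
    -- type D
    (∀ (M : Type*) [AddCommGroup M] [Module ℂ M] [Module (K (WD n)) M]
        [IsScalarTower ℂ (K (WD n)) M],
      (∃! ρ : Hx (kappaD (n := n) u) →ₐ[ℂ] Module.End ℂ M, IsTrivialExtension ρ) ∧
      ∀ ρ : Hx (kappaD (n := n) u) →ₐ[ℂ] Module.End ℂ M, IsTrivialExtension ρ →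
        Function.Bijective (ident ρ) ∧
        ∀ (i : Fin n) (f : MvPolynomial (Fin n) ℂ) (m : M),
          x (kappaD u) i • ident ρ (f ⊗ₜ[ℂ] m) =
            ident ρ
              (u • ∑ k ∈ univ.erase i,
                  exactDiv (f - (s k i).actPoly f) (X i - X k) ⊗ₜ[ℂ]
                    (((1 + K.c k * K.c i) * K.w (sD k i) : K (WD n)) • m)
                + u • ∑ k ∈ univ.erase i,
                  exactDiv (f - (sbar k i).actPoly f) (X i + X k) ⊗ₜ[ℂ]
                    (((1 - K.c k * K.c i) * K.w (sbarD k i) : K (WD n)) • m))) := by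
  refine ⟨fun M _ _ _ _ => ?_, fun M _ _ _ _ => ?_, fun M _ _ _ _ => ?_⟩
  · rw [kappaB_eq]
    refine ⟨(induced_module (WB n) M u _).1, fun ρ hρ =>
      ⟨((induced_module (WB n) M u _).2 ρ hρ).1, fun i f m => ?_⟩⟩
    -- The separate sums over `s` and `s̄` are merged to match the inner sum over the two values of
    -- `σ`.
    rw [hρ.x_smul_ident, ← smul_add, ← sum_add_distrib, K.el_of_mem (mem_WB (tau i))]
    congr 3
    refine sum_congr rfl fun k hk => ?_
    rw [sum_sign, reflDiff_one_apply (ne_of_mem_erase hk),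
      reflDiff_neg_one_apply (ne_of_mem_erase hk), K.reflEl_one (mem_WB (s k i)),
      K.reflEl_neg_one (mem_WB (sbar k i))]
    rfl
  · rw [kappaA_eq]
    refine ⟨(induced_module (WA n) M u _).1, fun ρ hρ =>
      ⟨((induced_module (WA n) M u _).2 ρ hρ).1, fun i f m => ?_⟩⟩
    rw [hρ.x_smul_ident, zero_smul, add_zero]
    congr 2
    refine sum_congr rfl fun k hk => ?_
    rw [sum_sign, reflDiff_one_apply (ne_of_mem_erase hk),
      K.reflEl_neg_one_of_notMem (sbar_notMem_WA (ne_of_mem_erase hk)), zero_smul,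
      TensorProduct.tmul_zero, add_zero, K.reflEl_one (s_mem_WA k i)]
    rfl
  · rw [kappaD_eq]
    refine ⟨(induced_module (WD n) M u _).1, fun ρ hρ =>
      ⟨((induced_module (WD n) M u _).2 ρ hρ).1, fun i f m => ?_⟩⟩
    rw [hρ.x_smul_ident, zero_smul, add_zero, ← smul_add, ← sum_add_distrib]
    congr 2
    refine sum_congr rfl fun k hk => ?_
    rw [sum_sign, reflDiff_one_apply (ne_of_mem_erase hk),
      reflDiff_neg_one_apply (ne_of_mem_erase hk), K.reflEl_one (s_mem_WD k i),
      K.reflEl_neg_one (sbar_mem_WD k i)]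
    rfl
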